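/- Throughout, states are density operators on finite-dimensional Hilbert spaces, quantum channels are completely positive trace preserving linear maps, and $\log$ is to base $2$ (with $\log\log x=-\infty$ for $x\le 1$ and $\log\log\infty=\infty$). A *system* $S$ (from a sender to a receiver) consists, for each block length $n$, of a finite-dimensional Hilbert space $\mathcal H_n$ of the receiver and a set $\mathcal S_n$ of states on $\mathcal H_n$, namely those which the sender can bring about. An $(n,\lambda_1,\lambda_2)$-identification code of size $N$ for $S$ is a family $(\rho_i,D_i)_{i=1}^N$ with $\rho_i\in\mathcal S_n$, $0\le D_i\le 1$ on $\mathcal H_n$, $\operatorname{Tr}(\rho_iD_i)\ge 1-\lambda_1$ for all $i$, and $\operatorname{Tr}(\rho_iD_j)\le\lambda_2$ for all $i\ne j$. Let $N(n,\lambda_1,\lambda_2)\in\mathbb N\cup\{\infty\}$ be the supremum of the sizes of such codes. The identification capacity of $S$ is $$C_{\mathrm{ID}}(S)=\inf_{\lambda_1,\lambda_2>0}\ \liminf_{n\to\infty}\ \frac1n\log\log N(n,\lambda_1,\lambda_2)\in[-\infty,\infty].$$ Let $\Phi_{2^k}$ be the state of $k$ EPR pairs, i.e. the projector onto $2^{-k/2}\sum_{j=1}^{2^k}|j\rangle|j\rangle$.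 We say that $S$ supplies, in block length $n$ and up to error $\varepsilon$, $k$ EPR pairs together with the transmission of a $\Delta$-dimensional quantum system, if there is a channel $R:\mathcal B(\mathcal H_n)\to\mathcal B(\mathbb C^{2^k}\otimes\mathbb C^{\Delta})$ such that for every channel $T:\mathcal B(\mathbb C^{2^k})\to\mathcal B(\mathbb C^\Delta)$ there is $\sigma\in\mathcal S_n$ with $\frac12\|R(\sigma)-(\mathrm{id}\otimes T)\Phi_{2^k}\|_1\le\varepsilon$. We say that $S$ *supplies EPR pairs at rate $E$ and allows (even only negligible) communication* if for all $\varepsilon,\delta>0$ and all $M\in\mathbb N$, for all sufficiently large $n$ there are $k\ge n(E-\delta)$ and $\Delta\ge M$ such that $S$ supplies, in block length $n$ and up to error $\varepsilon$, $k$ EPR pairs together with the transmission of a $\Delta$-dimensional quantum system. (Thus $\log\Delta$ only has to become unbounded; the rate of communication may be zero.) **Theorem.** Let $E\ge 0$. 1. Every system $S$ that supplies EPR pairs at rate $E$ and allows (even only negligible) communication satisfies $C_{\mathrm{ID}}(S)\ge 2E$. 2. This is tight if the only resources are the entanglement and negligible communication: let $k_n\in\mathbb N$ and positive integers $\Delta_n$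 satisfy $k_n/n\to E$ and $\frac1n\log\Delta_n\to0$, and let $S$ be the system in which, in block length $n$, sender and receiver share $k_n$ EPR pairs and the sender may apply any channel to her halves and transmit a $\Delta_n$-dimensional system, i.e. $\mathcal H_n=\mathbb C^{2^{k_n}}\otimes\mathbb C^{\Delta_n}$ and $\mathcal S_n=\{(\mathrm{id}\otimes T)\Phi_{2^{k_n}} : T:\mathcal B(\mathbb C^{2^{k_n}})\to\mathcal B(\mathbb C^{\Delta_n})\text{ a channel}\}$. Then $C_{\mathrm{ID}}(S)\le 2E$; and if moreover $\Delta_n\to\infty$, then $C_{\mathrm{ID}}(S)=2E$. -/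

import Mathlib

open Filter Topology
open scoped ENNReal ComplexOrder

noncomputable section

namespace QuantumID

/-- A density operator on the Hilbert space with orthonormal basis `a`. -/
structure IsState {a : Type} [Fintype a] (ρ : Matrix a a ℂ) : Prop where
  posSemidef : ρ.PosSemidef
  trace_eq_one : ρ.trace = 1

/-- An effect: an operator `D` with `0 ≤ D ≤ 1`. -/
structure IsEffect {a : Type} [Fintype a] [DecidableEq a] (D : Matrix a a ℂ) : Prop where
  nonneg : D.PosSemidef
  le_one : (1 - D).PosSemidef

/-- The amplified map `id_r ⊗ T`: it applies `T` to each `a × a` block of a matrix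
indexed by `r × a`. -/
def ampl {a b r : Type} (T : Matrix a a ℂ →ₗ[ℂ] Matrix b b ℂ)
    (M : Matrix (r × a) (r × a) ℂ) : Matrix (r × b) (r × b) ℂ :=
  Matrix.of fun p q => T (Matrix.of fun x y => M (p.1, x) (q.1, y)) p.2 q.2

/-- A quantum channel: a completely positive trace preserving linear map. -/
structure IsChannel {a b : Type} [Fintype a] [Fintype b]
    (T : Matrix a a ℂ →ₗ[ℂ] Matrix b b ℂ) : Prop where
  completelyPositive : ∀ (r : Type) [Fintype r] (M : Matrix (r × a) (r × a) ℂ),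
    M.PosSemidef → (ampl T M).PosSemidef
  tracePreserving : ∀ M : Matrix a a ℂ, (T M).trace = M.trace

/-- The vector `|Φ⟩ = d^{-1/2} ∑ⱼ |j⟩|j⟩`, where `d` is the number of elements of `ι`. -/
def maxEntVec (ι : Type) [Fintype ι] [DecidableEq ι] : ι × ι → ℂ :=
  fun p => if p.1 = p.2 then (((Real.sqrt (Fintype.card ι))⁻¹ : ℝ) : ℂ) else 0

/-- The maximally entangled state `|Φ⟩⟨Φ|`. -/
def maxEnt (ι : Type) [Fintype ι] [DecidableEq ι] : Matrix (ι × ι) (ι × ι) ℂ :=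
  Matrix.vecMulVec (maxEntVec ι) (star (maxEntVec ι))

/-- The basis of one party's half (`k` qubits) of `k` EPR pairs. -/
abbrev Qubits (k : ℕ) : Type := Fin k → Fin 2

/-- Sender and receiver share `k` EPR pairs; the sender applies the channel `T` to all of
her halves and transmits the `Δ`-dimensional output. This is the resulting state
`(id ⊗ T) Φ` of the receiver. -/
def assistedState (k Δ : ℕ)
    (T : Matrix (Qubits k) (Qubits k) ℂ →ₗ[ℂ] Matrix (Fin Δ) (Fin Δ) ℂ) :
    Matrix (Qubits k × Fin Δ) (Qubits k × Fin Δ) ℂ :=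
  ampl T (maxEnt (Qubits k))

theorem maxEnt_trace (ι : Type) [Fintype ι] [DecidableEq ι] [Nonempty ι] :
    (maxEnt ι).trace = 1 := by
  have hc : ((Fintype.card ι : ℝ)) ≠ 0 := by
    exact_mod_cast Fintype.card_ne_zero
  have h1 : ((Real.sqrt (Fintype.card ι))⁻¹ : ℝ) * (Real.sqrt (Fintype.card ι))⁻¹
      = (Fintype.card ι : ℝ)⁻¹ := by
    rw [← mul_inv, Real.mul_self_sqrt (Nat.cast_nonneg _)]
  have h2 : ∀ i j : ι, maxEntVec ι (i, j) * star (maxEntVec ι (i, j))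
      = if i = j then (((Fintype.card ι : ℝ)⁻¹ : ℝ) : ℂ) else 0 := by
    intro i j
    unfold maxEntVec
    split_ifs with h
    · rw [← h1]
      simp only [Complex.star_def, Complex.conj_ofReal, Complex.ofReal_mul]
    · simp
  simp only [maxEnt, Matrix.trace, Matrix.diag, Matrix.vecMulVec_apply, Pi.star_apply,
    Fintype.sum_prod_type, h2]
  simp only [Finset.sum_ite_eq, Finset.mem_univ, if_true, Finset.sum_const, Finset.card_univ,
    nsmul_eq_mul]
  rw [Complex.ofReal_inv, Complex.ofReal_natCast]
  exact mul_inv_cancel₀ (by exact_mod_cast hc)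

theorem assistedState_isState (k Δ : ℕ)
    (T : Matrix (Qubits k) (Qubits k) ℂ →ₗ[ℂ] Matrix (Fin Δ) (Fin Δ) ℂ) (hT : IsChannel T) :
    IsState (assistedState k Δ T) := by
  refine ⟨hT.completelyPositive _ _ (Matrix.posSemidef_vecMulVec_self_star _), ?_⟩
  rw [← maxEnt_trace (Qubits k)]
  simp only [assistedState, Matrix.trace, Fintype.sum_prod_type]
  refine Finset.sum_congr rfl fun i _ => ?_
  exact hT.tracePreserving (Matrix.of fun x y => maxEnt (Qubits k) (i, x) (i, y))

/-- A communication system from a sender to a receiver. For each block length `n` it is given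
by the Hilbert space that the receiver holds at the end (with basis `Out n`) and by the set of
the states on it which the sender can bring about, by any of the strategies open to her. -/
structure System where
  Out : ℕ → Type
  fintypeOut : ∀ n, Fintype (Out n)
  decEqOut : ∀ n, DecidableEq (Out n)
  states : ∀ n, Set (Matrix (Out n) (Out n) ℂ)
  isState : ∀ n, ∀ σ ∈ states n, IsState σ

attribute [instance] System.fintypeOut System.decEqOut

/-- An `(n, l₁, l₂)`-identification code with `N` messages for the system `S`, with errors
`l₁` of first and `l₂` of second kind. -/
structure IsIDCode (S : System) (n : ℕ) (l₁ l₂ : ℝ) {N : ℕ}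
    (ρ D : Fin N → Matrix (S.Out n) (S.Out n) ℂ) : Prop where
  state_mem : ∀ i, ρ i ∈ S.states n
  effect : ∀ i, IsEffect (D i)
  first_kind : ∀ i, 1 - l₁ ≤ (ρ i * D i).trace.re
  second_kind : ∀ i j, i ≠ j → (ρ i * D j).trace.re ≤ l₂

/-- The largest size `N(n, l₁, l₂)` of an identification code (`∞` if the sizes are
unbounded). -/
def maxSize (S : System) (n : ℕ) (l₁ l₂ : ℝ) : ℝ≥0∞ :=
  ⨆ (N : ℕ) (_ : ∃ ρ D : Fin N → Matrix (S.Out n) (S.Out n) ℂ, IsIDCode S n l₁ l₂ ρ D),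
    (N : ℝ≥0∞)

/-- Logarithm to base `2`, with `log 0 = -∞` and `log ∞ = ∞`. -/
def log2 (x : ℝ≥0∞) : EReal := ENNReal.log x / ((Real.log 2 : ℝ) : EReal)

/-- `log log x`, equal to `-∞` for `x ≤ 1`. -/
def loglog (x : ℝ≥0∞) : EReal := log2 (log2 x).toENNReal

/-- The identification capacity
`inf_{l₁, l₂ > 0} liminf_{n → ∞} (1 / n) log log N(n, l₁, l₂)`. -/
def idCapacity (S : System) : EReal :=
  ⨅ (l₁ : ℝ) (_ : 0 < l₁) (l₂ : ℝ) (_ : 0 < l₂),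
    liminf (fun n : ℕ => loglog (maxSize S n l₁ l₂) / ((n : ℝ) : EReal)) atTop

/-- In block length `n` the system can supply, up to error `ε`, `k` EPR pairs together with the
transmission of a `Δ`-dimensional quantum system: with one fixed decoding channel `R` of the
receiver, whatever channel `T` the sender wants to apply to her halves of the pairs before
transmitting the output, she has a strategy after which the receiver holds, up to `ε`, the
state `(id ⊗ T) Φ`. Errors are in trace distance `½‖·‖₁`, i.e. uniform over effects. -/
def Supplies (S : System) (n k Δ : ℕ) (ε : ℝ) : Prop :=
  ∃ R : Matrix (S.Out n) (S.Out n) ℂ →ₗ[ℂ] Matrix (Qubits k × Fin Δ) (Qubits k × Fin Δ) ℂ,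
    IsChannel R ∧
    ∀ T : Matrix (Qubits k) (Qubits k) ℂ →ₗ[ℂ] Matrix (Fin Δ) (Fin Δ) ℂ, IsChannel T →
      ∃ σ ∈ S.states n, ∀ D : Matrix (Qubits k × Fin Δ) (Qubits k × Fin Δ) ℂ, IsEffect D →
        |(R σ * D).trace.re - (assistedState k Δ T * D).trace.re| ≤ ε

/-- EPR pairs are available at rate `E`, and (even only negligible) communication is possible:
with vanishing error the system supplies `n (E - o(1))` EPR pairs and the transmission of a
quantum system of dimension `Δₙ → ∞`. Nothing is asked of the growth of `Δₙ`, so that the rate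
of the communication may be zero. -/
def SuppliesEntanglementAtRate (S : System) (E : ℝ) : Prop :=
  ∀ ε > (0 : ℝ), ∀ δ > (0 : ℝ), ∀ M : ℕ, ∀ᶠ n : ℕ in atTop,
    ∃ k Δ : ℕ, (E - δ) * n ≤ k ∧ M ≤ Δ ∧ Supplies S n k Δ ε

/-- The system whose only resources are, in block length `n`, `k n` EPR pairs and one
transmission of a `Δ n`-dimensional quantum system from the sender to the receiver. -/
def entanglementOnly (k Δ : ℕ → ℕ) : System where
  Out n := Qubits (k n) × Fin (Δ n)
  fintypeOut _ := inferInstance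
  decEqOut _ := inferInstance
  states n := {σ | ∃ T, IsChannel T ∧ σ = assistedState (k n) (Δ n) T}
  isState := by
    rintro n σ ⟨T, hT, rfl⟩
    exact assistedState_isState _ _ T hT

end QuantumID

end

namespace QuantumID

/-- The sign `±1` encoded by a bit. -/
noncomputable def sgn (b : Bool) : ℝ := if b then 1 else -1

theorem sgn_mul_self (b : Bool) : sgn b * sgn b = 1 := by cases b <;> simp [sgn]

theorem sgn_not (b : Bool) : sgn (!b) = -sgn b := by cases b <;> simp [sgn]

section Subgaussian

variable {ι L : Type*} [Fintype ι] [DecidableEq ι] [Fintype L]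

theorem sum_exp_sum_sgn_le (w : ι → ℝ) :
    ∑ g : ι → Bool, Real.exp (∑ i, w i * sgn (g i)) ≤
      2 ^ Fintype.card ι * Real.exp (∑ i, w i ^ 2 / 2) := by
  have h : ∑ g : ι → Bool, Real.exp (∑ i, w i * sgn (g i))
      = ∏ i, ∑ b : Bool, Real.exp (w i * sgn b) := by
    rw [Finset.prod_univ_sum, Fintype.piFinset_univ]
    simp only [Real.exp_sum]
  have h2 : (2 : ℝ) ^ Fintype.card ι = ∏ _i : ι, 2 := by simp
  rw [h, Real.exp_sum, h2, ← Finset.prod_mul_distrib]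
  refine Finset.prod_le_prod (fun i _ => by positivity) fun i _ => ?_
  have := Real.cosh_le_exp_half_sq (w i)
  rw [Real.cosh_eq] at this
  simp only [Fintype.sum_bool, sgn]
  norm_num
  linarith

theorem integral_exp_neg_sq_add_mul (v : ℝ) :
    ∫ x : ℝ, Real.exp (-x ^ 2 + x * v) = √Real.pi * Real.exp (v ^ 2 / 4) := by
  have h : ∀ x : ℝ, Real.exp (-x ^ 2 + x * v)
      = Real.exp (v ^ 2 / 4) * Real.exp (-1 * (x - v / 2) ^ 2) := by
    intro x
    rw [← Real.exp_add]
    congr 1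
    ring
  simp only [h]
  rw [MeasureTheory.integral_const_mul,
    MeasureTheory.integral_sub_right_eq_self (fun x : ℝ => Real.exp (-1 * x ^ 2)),
    integral_gaussian]
  rw [div_one, mul_comm]

theorem integrable_exp_neg_sq_add_mul (v : ℝ) :
    MeasureTheory.Integrable fun x : ℝ => Real.exp (-x ^ 2 + x * v) := by
  by_contra h
  have h1 := integral_exp_neg_sq_add_mul v
  rw [MeasureTheory.integral_undef h] at h1
  have : 0 < √Real.pi * Real.exp (v ^ 2 / 4) := by positivity
  linarith

/-- The moment generating function of a quadratic form of rank at most `card L` in random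
signs is bounded by that of its Gaussian counterpart. -/
theorem sum_exp_quadratic_le (u : L → ι → ℝ)
    (hu : ∀ z : L → ℝ, ∑ i, (∑ l, z l * u l i) ^ 2 ≤ ∑ l, z l ^ 2) :
    ∑ g : ι → Bool, Real.exp ((∑ l, (∑ i, u l i * sgn (g i)) ^ 2) / 4) ≤
      2 ^ Fintype.card ι * √2 ^ Fintype.card L := by
  have hpi : 0 < √Real.pi := by positivity
  have key : ∀ v : L → ℝ, √Real.pi ^ Fintype.card L * Real.exp ((∑ l, v l ^ 2) / 4)
      = ∫ x : L → ℝ, ∏ l, Real.exp (-x l ^ 2 + x l * v l) := by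
    intro v
    rw [MeasureTheory.integral_fintype_prod_volume_eq_prod
      (fun l (x : ℝ) => Real.exp (-x ^ 2 + x * v l))]
    simp only [integral_exp_neg_sq_add_mul, Finset.prod_mul_distrib, ← Real.exp_sum,
      Finset.sum_div]
    simp
  have hint : ∀ v : L → ℝ, MeasureTheory.Integrable
      fun x : L → ℝ => ∏ l, Real.exp (-x l ^ 2 + x l * v l) := fun v =>
    MeasureTheory.Integrable.fintype_prod (f := fun l (x : ℝ) => Real.exp (-x ^ 2 + x * v l))
      fun l => integrable_exp_neg_sq_add_mul (v l)
  have hint2 : MeasureTheory.Integrable fun x : L → ℝ => ∏ l, Real.exp (-(1 / 2) * x l ^ 2) :=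
    MeasureTheory.Integrable.fintype_prod (f := fun _ (x : ℝ) => Real.exp (-(1 / 2) * x ^ 2))
      fun l => integrable_exp_neg_mul_sq (by norm_num)
  have hval : ∫ x : L → ℝ, ∏ l, Real.exp (-(1 / 2) * x l ^ 2)
      = (√Real.pi * √2) ^ Fintype.card L := by
    rw [MeasureTheory.integral_fintype_prod_volume_eq_prod
      (fun _ (x : ℝ) => Real.exp (-(1 / 2) * x ^ 2))]
    simp only [integral_gaussian, Finset.prod_const, Finset.card_univ]
    rw [← Real.sqrt_mul Real.pi_pos.le]
    congr 2
    ring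
  refine le_of_mul_le_mul_left ?_ (pow_pos hpi (Fintype.card L))
  rw [Finset.mul_sum]
  simp only [key]
  rw [← MeasureTheory.integral_finsetSum _ fun g _ => hint _]
  calc _ ≤ ∫ x : L → ℝ, 2 ^ Fintype.card ι * ∏ l, Real.exp (-(1 / 2) * x l ^ 2) := by
        refine MeasureTheory.integral_mono
          (MeasureTheory.integrable_finsetSum _ fun g _ => hint _) (hint2.const_mul _) ?_
        intro x
        have h1 : ∀ g : ι → Bool,
            ∏ l, Real.exp (-x l ^ 2 + x l * ∑ i, u l i * sgn (g i))
              = Real.exp (-∑ l, x l ^ 2) *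
                Real.exp (∑ i, (∑ l, x l * u l i) * sgn (g i)) := by
          intro g
          rw [← Real.exp_sum, ← Real.exp_add, Finset.sum_add_distrib, Finset.sum_neg_distrib]
          congr 2
          simp only [Finset.mul_sum, Finset.sum_mul]
          rw [Finset.sum_comm]
          simp only [mul_assoc]
        simp only [h1, ← Finset.mul_sum]
        calc _ ≤ Real.exp (-∑ l, x l ^ 2) * (2 ^ Fintype.card ι *
                Real.exp (∑ i, (∑ l, x l * u l i) ^ 2 / 2)) := by
              gcongr
              exact sum_exp_sum_sgn_le _
          _ ≤ Real.exp (-∑ l, x l ^ 2) * (2 ^ Fintype.card ι *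
                Real.exp ((∑ l, x l ^ 2) / 2)) := by
              rw [← Finset.sum_div]
              gcongr
              exact hu x
          _ = _ := by
              rw [← Real.exp_sum, mul_left_comm, ← Real.exp_add, ← Finset.mul_sum]
              congr 2
              ring
    _ = _ := by
        rw [MeasureTheory.integral_const_mul, hval, mul_pow]
        ring

/-- Large deviations of a sum of quadratic forms of rank at most `a` in independent random
sign vectors. -/
theorem card_quadratic_tail {C : Type*} [Fintype C] [DecidableEq C] (Lc : C → Type)
    [∀ c, Fintype (Lc c)] (u : ∀ c, Lc c → ι → ℝ)
    (hu : ∀ c, ∀ z : Lc c → ℝ, ∑ i, (∑ l, z l * u c l i) ^ 2 ≤ ∑ l, z l ^ 2)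
    (a : ℕ) (ha : ∀ c, Fintype.card (Lc c) ≤ a) :
    ((Finset.univ.filter fun ω : C → ι → Bool =>
      8 * (a : ℝ) * Fintype.card C < ∑ c, ∑ l, (∑ i, u c l i * sgn (ω c i)) ^ 2).card : ℝ) ≤
      Fintype.card (C → ι → Bool) * Real.exp (-(a * Fintype.card C)) := by
  set B := Finset.univ.filter fun ω : C → ι → Bool =>
      8 * (a : ℝ) * Fintype.card C < ∑ c, ∑ l, (∑ i, u c l i * sgn (ω c i)) ^ 2 with hB
  set D : ℝ := (Fintype.card C : ℝ) with hD
  have hs : √2 ≤ Real.exp 1 := by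
    have h1 : √2 ≤ 2 := by
      rw [Real.sqrt_le_left (by norm_num)]; norm_num
    have := Real.add_one_le_exp (1 : ℝ)
    linarith
  have h1 : (B.card : ℝ) * Real.exp (2 * a * D) ≤
      ∑ ω : C → ι → Bool, Real.exp (∑ c, (∑ l, (∑ i, u c l i * sgn (ω c i)) ^ 2) / 4) := by
    calc (B.card : ℝ) * Real.exp (2 * a * D) = ∑ _ω ∈ B, Real.exp (2 * a * D) := by simp
      _ ≤ ∑ ω ∈ B, Real.exp (∑ c, (∑ l, (∑ i, u c l i * sgn (ω c i)) ^ 2) / 4) := by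
          refine Finset.sum_le_sum fun ω hω => ?_
          rw [hB, Finset.mem_filter] at hω
          rw [← Finset.sum_div]
          gcongr
          linarith [hω.2]
      _ ≤ _ := Finset.sum_le_sum_of_subset_of_nonneg (Finset.subset_univ _)
          fun _ _ _ => by positivity
  have h2 : ∑ ω : C → ι → Bool,
      Real.exp (∑ c, (∑ l, (∑ i, u c l i * sgn (ω c i)) ^ 2) / 4) ≤
      Fintype.card (C → ι → Bool) * Real.exp (a * D) := by
    have h : ∑ ω : C → ι → Bool,
        Real.exp (∑ c, (∑ l, (∑ i, u c l i * sgn (ω c i)) ^ 2) / 4)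
        = ∏ c, ∑ g : ι → Bool, Real.exp ((∑ l, (∑ i, u c l i * sgn (g i)) ^ 2) / 4) := by
      rw [Finset.prod_univ_sum, Fintype.piFinset_univ]
      simp only [Real.exp_sum]
    rw [h]
    calc _ ≤ ∏ _c : C, ((2 : ℝ) ^ Fintype.card ι * Real.exp a) := by
          refine Finset.prod_le_prod
            (fun c _ => Finset.sum_nonneg fun _ _ => (Real.exp_pos _).le) fun c _ => ?_
          refine (sum_exp_quadratic_le (u c) (hu c)).trans ?_
          gcongr
          calc √2 ^ Fintype.card (Lc c) ≤ √2 ^ a := by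
                refine pow_le_pow_right₀ ?_ (ha c)
                rw [Real.one_le_sqrt]; norm_num
            _ ≤ Real.exp 1 ^ a := by gcongr
            _ = Real.exp a := by rw [← Real.exp_nat_mul, mul_one]
      _ = _ := by
          rw [Finset.prod_const, mul_pow, Finset.card_univ, ← Real.exp_nat_mul, mul_comm (a : ℝ)]
          simp [hD]
  have h3 := h1.trans h2
  have h4 : Real.exp (a * D) = Real.exp (-(a * D)) * Real.exp (2 * a * D) := by
    rw [← Real.exp_add]; congr 1; ring
  rw [h4, ← mul_assoc] at h3
  exact le_of_mul_le_mul_right h3 (Real.exp_pos _)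

end Subgaussian

section SecondMoment

variable {ι C : Type*} [Fintype ι] [DecidableEq ι] [Fintype C] [DecidableEq C]

theorem sum_sgn_mul_eq_zero {i j : ι} (hij : i ≠ j) {c c' : C} (hc : c ≠ c') :
    ∑ ω : C → ι → Bool, (sgn (ω c i) * sgn (ω c j)) * (sgn (ω c' i) * sgn (ω c' j)) = 0 := by
  let F : (C → ι → Bool) → ℝ := fun ω =>
    (sgn (ω c i) * sgn (ω c j)) * (sgn (ω c' i) * sgn (ω c' j))
  let fl : (C → ι → Bool) → (C → ι → Bool) := fun ω =>
    Function.update ω c (Function.update (ω c) i (!(ω c i)))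
  have hinv : Function.Involutive fl := by
    intro ω
    funext x y
    by_cases hx : x = c
    · subst hx
      by_cases hy : y = i
      · subst hy; simp [fl]
      · simp [fl, hy]
    · simp [fl, hx]
  have hneg : ∀ ω, F (fl ω) = -F ω := by
    intro ω
    simp only [F, fl, Function.update_self, Function.update_of_ne hc.symm,
      Function.update_of_ne hij.symm, sgn_not]
    ring
  have h := Equiv.sum_comp (hinv.toPerm fl) F
  have h2 : ∑ ω, F (hinv.toPerm fl ω) = -∑ ω, F ω := by
    rw [← Finset.sum_neg_distrib]
    exact Finset.sum_congr rfl fun ω _ => hneg ω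
  change ∑ ω, F ω = 0
  linarith

theorem sum_sq_inner_rows {i j : ι} (hij : i ≠ j) :
    ∑ ω : C → ι → Bool, (∑ c, sgn (ω c i) * sgn (ω c j)) ^ 2
      = Fintype.card (C → ι → Bool) * Fintype.card C := by
  simp only [sq, Finset.sum_mul_sum]
  rw [Finset.sum_comm]
  have h : ∀ c : C, ∑ ω : C → ι → Bool, ∑ c' : C,
      (sgn (ω c i) * sgn (ω c j)) * (sgn (ω c' i) * sgn (ω c' j))
        = Fintype.card (C → ι → Bool) := by
    intro c
    rw [Finset.sum_comm, Finset.sum_eq_single c]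
    · have : ∀ ω : C → ι → Bool,
          (sgn (ω c i) * sgn (ω c j)) * (sgn (ω c i) * sgn (ω c j)) = 1 := by
        intro ω
        rw [mul_mul_mul_comm, sgn_mul_self, sgn_mul_self, one_mul]
      simp only [this, Finset.sum_const, Finset.card_univ, nsmul_eq_mul, mul_one]
    · intro c' _ hc
      exact sum_sgn_mul_eq_zero hij hc.symm
    · simp
  simp only [h, Finset.sum_const, Finset.card_univ, nsmul_eq_mul]
  ring

/-- At least half of the sign matrices have nearly orthogonal rows. -/
theorem card_le_two_mul_card_rows_nearly_orthogonal :
    (Fintype.card (C → ι → Bool) : ℝ) ≤ 2 * (Finset.univ.filter fun ω : C → ι → Bool =>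
      ∑ i, ∑ j, (if i = j then 0 else (∑ c, sgn (ω c i) * sgn (ω c j)) ^ 2) ≤
        2 * (Fintype.card ι : ℝ) ^ 2 * Fintype.card C).card := by
  set f : (C → ι → Bool) → ℝ := fun ω =>
    ∑ i, ∑ j, (if i = j then 0 else (∑ c, sgn (ω c i) * sgn (ω c j)) ^ 2) with hf
  set R : ℝ := (Fintype.card ι : ℝ) ^ 2 * Fintype.card C with hR
  set Ω : ℝ := (Fintype.card (C → ι → Bool) : ℝ) with hΩ
  have hΩ0 : 0 < Ω := by rw [hΩ]; exact_mod_cast Fintype.card_pos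
  have hf0 : ∀ ω, 0 ≤ f ω := fun ω => Finset.sum_nonneg fun i _ => Finset.sum_nonneg fun j _ => by
    split_ifs <;> positivity
  have hsum : ∑ ω, f ω ≤ Ω * R := by
    rw [hf, Finset.sum_comm]
    calc _ ≤ ∑ _i : ι, ∑ _j : ι, Ω * Fintype.card C := by
          refine Finset.sum_le_sum fun i _ => ?_
          rw [Finset.sum_comm]
          refine Finset.sum_le_sum fun j _ => ?_
          by_cases hij : i = j
          · simp only [hij, if_true, Finset.sum_const_zero]
            positivity
          · simp only [hij, if_false]
            exact (sum_sq_inner_rows hij).le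
      _ = Ω * R := by
          simp only [Finset.sum_const, Finset.card_univ, nsmul_eq_mul]
          ring
  have hR0 : 0 ≤ R := by positivity
  have e : (Finset.univ.filter fun ω => f ω ≤ 2 * (Fintype.card ι : ℝ) ^ 2 * Fintype.card C)
      = Finset.univ.filter fun ω => f ω ≤ 2 * R := by
    simp only [hR, mul_assoc]
  rw [e]
  have hsplit := Finset.card_filter_add_card_filter_not (s := (Finset.univ : Finset (C → ι → Bool)))
    (fun ω => f ω ≤ 2 * R)
  rw [Finset.card_univ] at hsplit
  have hsplit' : ((Finset.univ.filter fun ω => f ω ≤ 2 * R).card : ℝ)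
      + (Finset.univ.filter fun ω => ¬ f ω ≤ 2 * R).card = Ω := by rw [hΩ]; exact_mod_cast hsplit
  set B := Finset.univ.filter fun ω => ¬ f ω ≤ 2 * R with hB
  have hBsum : (B.card : ℝ) * (2 * R) ≤ Ω * R := by
    calc (B.card : ℝ) * (2 * R) = ∑ _ω ∈ B, 2 * R := by simp
      _ ≤ ∑ ω ∈ B, f ω := Finset.sum_le_sum fun ω hω => by
          rw [hB, Finset.mem_filter] at hω
          exact (not_le.mp hω.2).le
      _ ≤ ∑ ω, f ω := Finset.sum_le_sum_of_subset_of_nonneg (Finset.subset_univ _)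
          fun _ _ _ => hf0 _
      _ ≤ _ := hsum
  rcases hR0.eq_or_lt with h0 | h0
  · have hB0 : B = ∅ := by
      rw [hB, Finset.filter_eq_empty_iff]
      intro ω _ hω
      have h1 : f ω ≤ ∑ ω, f ω := Finset.single_le_sum (fun ω _ => hf0 ω) (Finset.mem_univ ω)
      rw [← h0] at hω hsum
      apply hω
      linarith
    rw [hB0] at hsplit'
    simp only [Finset.card_empty, Nat.cast_zero, add_zero] at hsplit'
    linarith
  · have : (B.card : ℝ) * 2 ≤ Ω := by
      refine le_of_mul_le_mul_right ?_ h0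
      linarith
    linarith

end SecondMoment

/-- A finite digraph with out-degrees at most `δ` on `n` vertices has an independent set of size
at least `n / (2δ + 1)`. -/
theorem exists_independent_of_outdegree_le {V : Type*} [DecidableEq V] (r : V → V → Prop)
    [DecidableRel r] (δ : ℝ) (s : Finset V)
    (hs : ∀ v ∈ s, ((s.filter fun w => r v w).card : ℝ) ≤ δ) :
    ∃ t ⊆ s, (s.card : ℝ) ≤ (2 * δ + 1) * t.card ∧ ∀ v ∈ t, ∀ w ∈ t, v ≠ w → ¬ r v w := by
  induction s using Finset.strongInduction with
  | H s ih =>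
    rcases s.eq_empty_or_nonempty with rfl | hne
    · exact ⟨∅, by simp⟩
    have hdc : ∑ w ∈ s, ((s.filter fun v => r v w).card : ℝ) ≤ ∑ _w ∈ s, δ := by
      have : ∑ w ∈ s, ((s.filter fun v => r v w).card : ℝ)
          = ∑ v ∈ s, ((s.filter fun w => r v w).card : ℝ) := by
        simp only [Finset.card_filter]
        push_cast
        exact Finset.sum_comm
      rw [this]
      exact Finset.sum_le_sum hs
    obtain ⟨w, hw, hwδ⟩ := Finset.exists_le_of_sum_le hne hdc
    set s' := s.filter fun v => v ≠ w ∧ ¬ r v w ∧ ¬ r w v with hs'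
    have hss : s' ⊂ s := by
      refine Finset.ssubset_iff_subset_ne.mpr ⟨Finset.filter_subset _ _, fun h => ?_⟩
      rw [← h, hs', Finset.mem_filter] at hw
      exact hw.2.1 rfl
    obtain ⟨t, hts, htc, hti⟩ := ih s' hss fun v hv => by
      refine le_trans ?_ (hs v (hss.subset hv))
      exact_mod_cast Finset.card_le_card (Finset.filter_subset_filter _ hss.subset)
    have hwt : w ∉ t := fun h => by
      have := hts h
      rw [hs', Finset.mem_filter] at this
      exact this.2.1 rfl
    refine ⟨insert w t, ?_, ?_, ?_⟩
    · exact Finset.insert_subset hw (hts.trans hss.subset)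
    · have hcov : s ⊆ s' ∪ ({w} ∪ (s.filter (fun v => r v w) ∪ s.filter fun v => r w v)) := by
        intro v hv
        simp only [hs', Finset.mem_union, Finset.mem_filter, Finset.mem_singleton]
        tauto
      have h1 : (s.card : ℝ) ≤ s'.card + (1 + ((s.filter fun v => r v w).card
          + (s.filter fun v => r w v).card)) := by
        have := (Finset.card_le_card hcov).trans ((Finset.card_union_le _ _).trans
          (Nat.add_le_add_left ((Finset.card_union_le _ _).trans
            (Nat.add_le_add_left (Finset.card_union_le _ _) _)) _))
        rw [Finset.card_singleton] at this
        exact_mod_cast this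
      rw [Finset.card_insert_of_notMem hwt]
      push_cast
      have := hs w hw
      linarith
    · intro v hv v' hv' hne'
      rw [Finset.mem_insert] at hv hv'
      rcases hv with rfl | hv <;> rcases hv' with rfl | hv'
      · exact absurd rfl hne'
      · have := hts hv'
        rw [hs', Finset.mem_filter] at this
        exact this.2.2.2
      · have := hts hv
        rw [hs', Finset.mem_filter] at this
        exact this.2.2.1
      · exact hti v hv v' hv' hne'

open Matrix

section Real

variable {ι C : Type*} [Fintype ι] [Fintype C]

theorem trace_mul_transpose_self (A : Matrix ι C ℝ) :
    (A * Aᵀ).trace = ∑ i, ∑ c, A i c ^ 2 := by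
  simp [Matrix.trace, Matrix.mul_apply, sq]

theorem posSemidef_mul_transpose_self (A : Matrix ι C ℝ) : (A * Aᵀ).PosSemidef := by
  have := Matrix.posSemidef_self_mul_conjTranspose A
  rwa [Matrix.conjTranspose_eq_transpose_of_trivial] at this

theorem trace_conj_le [DecidableEq ι] {Q : Matrix ι ι ℝ} (hQ : (1 - Q).PosSemidef) (A : Matrix ι ι ℝ) :
    (A * Q * Aᵀ).trace ≤ (A * Aᵀ).trace := by
  have h := (hQ.mul_mul_conjTranspose_same A).trace_nonneg
  rw [Matrix.conjTranspose_eq_transpose_of_trivial, Matrix.mul_sub, Matrix.sub_mul,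
    Matrix.trace_sub, Matrix.mul_one] at h
  linarith

/-- A matrix whose rows are nearly orthonormal is close to a contraction. The contraction is
`2 (1 + Γ Γᵀ)⁻¹ Γ`. -/
theorem exists_contraction_near [DecidableEq ι] (Γ : Matrix ι C ℝ) :
    ∃ V : Matrix ι C ℝ, (1 - V * Vᵀ).PosSemidef ∧
      Fintype.card ι - ((1 - Γ * Γᵀ) * (1 - Γ * Γᵀ)ᵀ).trace ≤ (V * Vᵀ).trace ∧
      ((V - Γ) * (V - Γ)ᵀ).trace ≤ ((1 - Γ * Γᵀ) * (1 - Γ * Γᵀ)ᵀ).trace := by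
  set W := Γ * Γᵀ with hW
  have hWT : Wᵀ = W := by rw [hW, Matrix.transpose_mul, Matrix.transpose_transpose]
  have hpd : (1 + W).PosDef := Matrix.PosDef.one.add_posSemidef (posSemidef_mul_transpose_self Γ)
  have hdet : IsUnit (1 + W).det := (Matrix.isUnit_iff_isUnit_det _).mp hpd.isUnit
  set Y := (1 + W)⁻¹ with hY
  have hYT : Yᵀ = Y := by
    rw [hY, Matrix.transpose_nonsing_inv, Matrix.transpose_add, hWT, Matrix.transpose_one]
  have hYW : Y * W = 1 - Y := by
    have := Matrix.nonsing_inv_mul _ hdet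
    rw [← hY, Matrix.mul_add, Matrix.mul_one] at this
    rw [← this]; abel
  have hWY : W * Y = 1 - Y := by
    have := Matrix.mul_nonsing_inv _ hdet
    rw [← hY, Matrix.add_mul, Matrix.one_mul] at this
    rw [← this]; abel
  have hYWY : (Y * Γ) * (Y * Γ)ᵀ = Y - Y * Y := by
    rw [Matrix.transpose_mul, hYT, Matrix.mul_assoc, ← Matrix.mul_assoc Γ, ← hW, hWY,
      Matrix.mul_sub, Matrix.mul_one]
  have hp1 : (Y - Y * Y).PosSemidef := hYWY ▸ posSemidef_mul_transpose_self (Y * Γ)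
  have hp2 : ((1 - Y) * (1 - Y)).PosSemidef := by
    have := posSemidef_mul_transpose_self (1 - Y)
    rwa [Matrix.transpose_sub, hYT, Matrix.transpose_one] at this
  have hp3 : (Y * Y).PosSemidef := by
    have := posSemidef_mul_transpose_self Y
    rwa [hYT] at this
  have hQ1 : (1 - Y * Y).PosSemidef := by
    have : 1 - Y * Y = (Y - Y * Y) + (Y - Y * Y) + (1 - Y) * (1 - Y) := by noncomm_ring
    rw [this]
    exact (hp1.add hp1).add hp2
  have hQ2 : (1 - (Y - Y * Y)).PosSemidef := by
    have : 1 - (Y - Y * Y) = (1 - Y) * (1 - Y) + Y * Y + (Y - Y * Y) := by noncomm_ring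
    rw [this]
    exact (hp2.add hp3).add hp1
  have hZY : (1 - W) * Y = 2 • Y - 1 := by
    rw [Matrix.sub_mul, hWY]; noncomm_ring
  have hVV : ((2 : ℝ) • (Y * Γ)) * ((2 : ℝ) • (Y * Γ))ᵀ = 1 - (2 • Y - 1) * (2 • Y - 1)ᵀ := by
    rw [Matrix.transpose_smul, Matrix.smul_mul, Matrix.mul_smul, hYWY, smul_smul,
      Matrix.transpose_sub, Matrix.transpose_smul, hYT, Matrix.transpose_one]
    have : ((2 : ℝ) * 2) • (Y - Y * Y) = 4 • (Y - Y * Y) := by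
      rw [← Nat.cast_smul_eq_nsmul ℝ]; norm_num
    rw [this]
    noncomm_ring
  have hsq : ((2 • Y - 1) * (2 • Y - 1)ᵀ).trace ≤ ((1 - W) * (1 - W)ᵀ).trace := by
    have := trace_conj_le hQ1 (1 - W)
    have e : (1 - W) * (Y * Y) * (1 - W)ᵀ = (2 • Y - 1) * (2 • Y - 1)ᵀ := by
      rw [← hZY, Matrix.transpose_mul, hYT]
      simp only [Matrix.mul_assoc]
    rwa [e] at this
  refine ⟨(2 : ℝ) • (Y * Γ), ?_, ?_, ?_⟩
  · rw [hVV, sub_sub_cancel]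
    exact posSemidef_mul_transpose_self _
  · rw [hVV, Matrix.trace_sub, Matrix.trace_one]
    linarith
  · have e : (2 : ℝ) • (Y * Γ) - Γ = (1 - W) * (Y * Γ) := by
      rw [← Matrix.mul_assoc, hZY, Matrix.sub_mul, Matrix.one_mul, Matrix.smul_mul,
        ← Nat.cast_smul_eq_nsmul ℝ]
      norm_num
    have e2 : ((2 : ℝ) • (Y * Γ) - Γ) * ((2 : ℝ) • (Y * Γ) - Γ)ᵀ
        = (1 - W) * (Y - Y * Y) * (1 - W)ᵀ := by
      rw [e, Matrix.transpose_mul, ← hYWY]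
      simp only [Matrix.mul_assoc]
    rw [e2]
    exact trace_conj_le hQ2 (1 - W)

/-- An orthonormal basis of the span of finitely many vectors, in coordinates. -/
theorem exists_orthonormal_basis_span {J : Type*} [Fintype J] (v : J → ι → ℝ) :
    ∃ r ≤ Fintype.card J, ∃ u : Fin r → ι → ℝ,
      (∀ z : Fin r → ℝ, ∑ i, (∑ l, z l * u l i) ^ 2 ≤ ∑ l, z l ^ 2) ∧
      (∀ t, ∑ l, (∑ i, u l i * v t i) ^ 2 = ∑ i, v t i ^ 2) ∧
      (∀ w : ι → ℝ, ∑ l, (∑ i, u l i * w i) ^ 2 ≤ ∑ i, w i ^ 2) := by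
  let v' : J → EuclideanSpace ℝ ι := fun t => WithLp.toLp 2 (v t)
  let S : Submodule ℝ (EuclideanSpace ℝ ι) := Submodule.span ℝ (Set.range v')
  let b := stdOrthonormalBasis ℝ S
  have hinner : ∀ (x : EuclideanSpace ℝ ι) (w : ι → ℝ),
      inner ℝ x (WithLp.toLp 2 w : EuclideanSpace ℝ ι) = ∑ i, x i * w i := by
    intro x w
    simp [PiLp.inner_apply, mul_comm]
  have hnorm : ∀ x : EuclideanSpace ℝ ι, ‖x‖ ^ 2 = ∑ i, x i ^ 2 := by
    intro x
    simp [EuclideanSpace.norm_sq_eq]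
  have hon : Orthonormal ℝ fun l => (b l : EuclideanSpace ℝ ι) :=
    b.orthonormal.comp_linearIsometry S.subtypeₗᵢ
  refine ⟨Module.finrank ℝ S, finrank_range_le_card v', fun l i => (b l : EuclideanSpace ℝ ι) i,
    ?_, ?_, ?_⟩
  · intro z
    have h := hon.inner_sum z z Finset.univ
    rw [real_inner_self_eq_norm_sq, hnorm] at h
    simp only [WithLp.ofLp_sum, WithLp.ofLp_smul, Finset.sum_apply, Pi.smul_apply,
      smul_eq_mul] at h
    rw [h]
    simp [sq]
  · intro t
    have hm : v' t ∈ S := Submodule.subset_span ⟨t, rfl⟩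
    have h := b.sum_sq_norm_inner_right ⟨v' t, hm⟩
    have h2 : ‖(⟨v' t, hm⟩ : S)‖ ^ 2 = ∑ i, v t i ^ 2 := by
      rw [Submodule.coe_norm]
      exact hnorm (v' t)
    rw [h2] at h
    rw [← h]
    refine Finset.sum_congr rfl fun l _ => ?_
    rw [Submodule.coe_inner, hinner, Real.norm_eq_abs, sq_abs]
  · intro w
    have h := hon.sum_inner_products_le (WithLp.toLp 2 w : EuclideanSpace ℝ ι) (s := Finset.univ)
    rw [hnorm] at h
    simpa only [hinner, Real.norm_eq_abs, sq_abs] using h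

end Real

section Real

variable {ι J L : Type*} [Fintype ι] [Fintype J] [Fintype L]

theorem trace_mul_projection (A : Matrix ι J ℝ) (U : Matrix L ι ℝ) :
    (A * Aᵀ * (Uᵀ * U)).trace = ∑ t, ∑ l, (∑ i, U l i * A i t) ^ 2 := by
  have : (A * Aᵀ * (Uᵀ * U)).trace = ((U * A) * (U * A)ᵀ).trace := by
    rw [Matrix.transpose_mul, Matrix.trace_mul_comm, Matrix.mul_assoc, Matrix.trace_mul_comm]
    simp only [Matrix.mul_assoc]
  rw [this, trace_mul_transpose_self, Finset.sum_comm]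
  simp only [Matrix.mul_apply]

theorem posSemidef_one_sub_transpose_mul [DecidableEq ι] (U : Matrix L ι ℝ)
    (hU : ∀ w : ι → ℝ, ∑ l, (∑ i, U l i * w i) ^ 2 ≤ ∑ i, w i ^ 2) :
    (1 - Uᵀ * U).PosSemidef := by
  refine Matrix.PosSemidef.of_dotProduct_mulVec_nonneg ?_ fun w => ?_
  · rw [Matrix.IsHermitian, Matrix.conjTranspose_eq_transpose_of_trivial]
    simp
  · rw [star_trivial, Matrix.sub_mulVec, Matrix.one_mulVec, dotProduct_sub,
      ← Matrix.mulVec_mulVec, Matrix.dotProduct_mulVec, Matrix.vecMul_transpose, sub_nonneg]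
    simpa [dotProduct, Matrix.mulVec, sq] using hU w

/-- The deviation of a normalized sign matrix from orthonormality of its rows. -/
theorem gram_deviation_sign_matrix [DecidableEq ι] [Nonempty J] (ω : J → ι → Bool) :
    let Γ : Matrix ι J ℝ := Matrix.of fun i c => sgn (ω c i) / √(Fintype.card J)
    ((1 - Γ * Γᵀ) * (1 - Γ * Γᵀ)ᵀ).trace =
      (∑ i, ∑ j, (if i = j then 0 else (∑ c, sgn (ω c i) * sgn (ω c j)) ^ 2)) /
        (Fintype.card J : ℝ) ^ 2 := by
  intro Γ
  have hD : (0 : ℝ) < Fintype.card J := by exact_mod_cast Fintype.card_pos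
  rw [trace_mul_transpose_self, Finset.sum_div]
  refine Finset.sum_congr rfl fun i _ => ?_
  rw [Finset.sum_div]
  refine Finset.sum_congr rfl fun j _ => ?_
  have h : (Γ * Γᵀ) i j = (∑ c, sgn (ω c i) * sgn (ω c j)) / Fintype.card J := by
    rw [Matrix.mul_apply, Finset.sum_div]
    refine Finset.sum_congr rfl fun c _ => ?_
    simp only [Γ, Matrix.of_apply, Matrix.transpose_apply]
    rw [div_mul_div_comm, Real.mul_self_sqrt hD.le]
  rw [Matrix.sub_apply, h]
  split_ifs with hij
  · subst hij
    simp only [sgn_mul_self, Matrix.one_apply_eq, Finset.sum_const, Finset.card_univ,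
      nsmul_eq_mul, mul_one]
    rw [div_self hD.ne']
    simp
  · rw [Matrix.one_apply_ne hij]
    ring

end Real

theorem two_pow_mul_six_le_exp {n : ℕ} (hn : 16 ≤ n) : 6 * (2 : ℝ) ^ n ≤ Real.exp n := by
  have he : (2.7 : ℝ) < Real.exp 1 := by linarith [Real.exp_one_gt_d9]
  have h1 : (2.7 : ℝ) ^ n ≤ Real.exp n := by
    calc (2.7 : ℝ) ^ n ≤ Real.exp 1 ^ n := by gcongr
      _ = Real.exp n := by rw [← Real.exp_nat_mul, mul_one]
  refine le_trans ?_ h1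
  have h2 : (2.7 : ℝ) ^ n = 1.35 ^ n * 2 ^ n := by rw [← mul_pow]; norm_num
  rw [h2]
  gcongr
  calc (6 : ℝ) ≤ 1.35 ^ 16 := by norm_num
    _ ≤ 1.35 ^ n := pow_le_pow_right₀ (by norm_num) hn

/-- Existence of `2 ^ d ^ 2` incomplete measurements `M` on a `d`-dimensional space with `4 ^ m`
outcomes and of tests `P` conditional on the outcome, such that a test accepts almost surely
the own post-measurement state, but rejects mostly all others. -/
theorem exists_measurement_code {ι : Type*} [Fintype ι] [DecidableEq ι] {m a : ℕ} (hm : 2 ≤ m)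
    (ha : 0 < a) (hι : Fintype.card ι = 2 ^ m * a) :
    ∃ N : ℕ, 2 ^ (Fintype.card ι ^ 2) ≤ N ∧
      ∃ M P : Fin N → Fin (4 ^ m) → Matrix ι ι ℝ,
        (∀ n x, (M n x).PosSemidef) ∧ (∀ n, (1 - ∑ x, M n x).PosSemidef) ∧
        (∀ n x, (P n x).PosSemidef) ∧ (∀ n x, (1 - P n x).PosSemidef) ∧
        (∀ n, (1 - 2 / 2 ^ m) * (Fintype.card ι : ℝ) ≤ ∑ x, (M n x * P n x).trace) ∧
        (∀ n n', n ≠ n' → ∑ x, (M n x * P n' x).trace ≤ 20 / 2 ^ m * Fintype.card ι) := by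
  classical
  set X := Fin (4 ^ m) with hX
  let C := X × Fin a
  have : NeZero a := ⟨ha.ne'⟩
  have : Nonempty C := ⟨(⟨0, by positivity⟩, 0)⟩
  set d : ℝ := (Fintype.card ι : ℝ) with hd
  set D : ℝ := (Fintype.card C : ℝ) with hD
  have hdval : d = 2 ^ m * a := by rw [hd, hι]; push_cast; rfl
  have hDnat : Fintype.card C = 2 ^ m * Fintype.card ι := by
    simp only [C, X, Fintype.card_prod, Fintype.card_fin, hι]
    rw [← mul_assoc, ← mul_pow]
    norm_num
  have hDval : D = 2 ^ m * d := by rw [hD, hDnat]; push_cast; rfl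
  have hm4 : (4 : ℝ) ≤ 2 ^ m := by
    calc (4 : ℝ) = 2 ^ 2 := by norm_num
      _ ≤ 2 ^ m := pow_le_pow_right₀ (by norm_num) hm
  have ha1 : (1 : ℝ) ≤ a := by exact_mod_cast ha
  have hd4 : (4 : ℝ) ≤ d := by rw [hdval]; nlinarith
  have hd0 : 0 < d := by linarith
  have hD0 : 0 < D := by rw [hDval]; positivity
  have haD : (a : ℝ) * D = d ^ 2 := by rw [hDval, hdval]; ring
  let Γ : (C → ι → Bool) → Matrix ι C ℝ := fun ω => Matrix.of fun i c => sgn (ω c i) / √D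
  choose V hV1 hV2 hV3 using fun ω => exists_contraction_near (Γ ω)
  choose r hr u hu1 hu2 hu3 using fun (ω : C → ι → Bool) (x : X) =>
    exists_orthonormal_basis_span fun (t : Fin a) (i : ι) => V ω i (x, t)
  let q : (C → ι → Bool) → ℝ := fun ω =>
      ∑ i, ∑ j, (if i = j then 0 else (∑ c, sgn (ω c i) * sgn (ω c j)) ^ 2)
  let G : Finset (C → ι → Bool) := Finset.univ.filter fun ω => q ω ≤ 2 * d ^ 2 * D
  have hG : (Fintype.card (C → ι → Bool) : ℝ) ≤ 2 * G.card :=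
    card_le_two_mul_card_rows_nearly_orthogonal
  have hZ : ∀ ω ∈ G, ((1 - Γ ω * (Γ ω)ᵀ) * (1 - Γ ω * (Γ ω)ᵀ)ᵀ).trace ≤ 2 * d / 2 ^ m := by
    intro ω hω
    have h := gram_deviation_sign_matrix ω
    simp only at h
    rw [h, div_le_iff₀ (by positivity)]
    have h2 : q ω ≤ 2 * d ^ 2 * D := (Finset.mem_filter.mp hω).2
    refine h2.trans (le_of_eq ?_)
    change 2 * d ^ 2 * D = 2 * d / 2 ^ m * D ^ 2
    rw [hDval]
    field_simp
  let rel : (C → ι → Bool) → (C → ι → Bool) → Prop := fun ω ω' =>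
    8 * (a : ℝ) * D < ∑ c : C, ∑ l, (∑ i, u ω c.1 l i * sgn (ω' c i)) ^ 2
  set δ : ℝ := Fintype.card (C → ι → Bool) * Real.exp (-(a * D)) with hδ
  obtain ⟨t, htG, htc, hti⟩ := exists_independent_of_outdegree_le rel δ G fun ω _ => by
    refine le_trans ?_ (card_quadratic_tail (fun c : C => Fin (r ω c.1))
      (fun c => u ω c.1) (fun c => hu1 ω c.1) a
      fun c => by simpa using hr ω c.1)
    exact Nat.cast_le.mpr (Finset.card_le_card fun ω' h =>
      Finset.mem_filter.mpr ⟨Finset.mem_univ _, (Finset.mem_filter.mp h).2⟩)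
  have hcount : (2 : ℝ) ^ (Fintype.card ι ^ 2) ≤ t.card := by
    have hΩ : (1 : ℝ) ≤ δ := by
      rw [hδ, haD, Real.exp_neg, ← div_eq_mul_inv, one_le_div (Real.exp_pos _)]
      have h1 : (Fintype.card (C → ι → Bool) : ℝ) = 2 ^ (2 ^ m * Fintype.card ι ^ 2) := by
        simp only [Fintype.card_fun, Fintype.card_bool, hDnat]
        push_cast
        rw [← pow_mul]
        congr 1
        ring
      rw [h1, pow_mul]
      calc Real.exp (d ^ 2) = Real.exp 1 ^ (Fintype.card ι ^ 2) := by
            rw [← Real.exp_nat_mul, mul_one]; push_cast; rfl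
        _ ≤ ((2 : ℝ) ^ 2 ^ m) ^ (Fintype.card ι ^ 2) := by
            gcongr
            have h2 : Real.exp 1 ≤ 2 ^ 2 := by linarith [Real.exp_one_lt_d9]
            refine h2.trans (pow_le_pow_right₀ (by norm_num) ?_)
            calc 2 = 2 ^ 1 := rfl
              _ ≤ 2 ^ m := Nat.pow_le_pow_right (by norm_num) (by omega)
    have h3 : (Fintype.card (C → ι → Bool) : ℝ) ≤ 6 * δ * t.card := by
      have ht0 : (0 : ℝ) ≤ t.card := Nat.cast_nonneg _
      nlinarith
    have hexp : Real.exp (d ^ 2) ≤ 6 * t.card := by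
      rw [hδ, haD, Real.exp_neg] at h3
      have hΩ0 : (0 : ℝ) < Fintype.card (C → ι → Bool) := by exact_mod_cast Fintype.card_pos
      have he := Real.exp_pos (d ^ 2)
      have h4 : (Fintype.card (C → ι → Bool) : ℝ) * Real.exp (d ^ 2) ≤
          Fintype.card (C → ι → Bool) * (6 * t.card) := by
        calc _ ≤ (6 * (Fintype.card (C → ι → Bool) * (Real.exp (d ^ 2))⁻¹) * t.card)
              * Real.exp (d ^ 2) := by gcongr
          _ = _ := by field_simp
      exact le_of_mul_le_mul_left h4 hΩ0
    have h16 : 16 ≤ Fintype.card ι ^ 2 := by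
      have : 4 ≤ Fintype.card ι := by
        rw [hd] at hd4
        exact_mod_cast hd4
      nlinarith
    have h6 := two_pow_mul_six_le_exp h16
    push_cast at h6
    change 6 * (2 : ℝ) ^ Fintype.card ι ^ 2 ≤ Real.exp (d ^ 2) at h6
    linarith
  let A : (C → ι → Bool) → X → Matrix ι (Fin a) ℝ := fun ω x =>
    (V ω).submatrix id fun t => (x, t)
  let U : ∀ (ω : C → ι → Bool) (x : X), Matrix (Fin (r ω x)) ι ℝ := fun ω x => Matrix.of (u ω x)
  have hsumA : ∀ ω, ∑ x, A ω x * (A ω x)ᵀ = V ω * (V ω)ᵀ := by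
    intro ω
    ext i j
    rw [Matrix.sum_apply]
    simp only [A, Matrix.mul_apply, Matrix.submatrix_apply, Matrix.transpose_apply, id]
    exact (Fintype.sum_prod_type fun c : C => V ω i c * V ω j c).symm
  have hsq : ∀ a b : ℝ, a ^ 2 ≤ 2 * b ^ 2 + 2 * (a - b) ^ 2 := fun a b => by
    nlinarith [sq_nonneg (a - 2 * b)]
  let e := t.equivFin.symm
  refine ⟨t.card, by exact_mod_cast hcount, fun n x => A (e n) x * (A (e n) x)ᵀ,
    fun n x => (U (e n) x)ᵀ * U (e n) x, ?_, ?_, ?_, ?_, ?_, ?_⟩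
  · exact fun n x => posSemidef_mul_transpose_self _
  · intro n
    rw [hsumA]
    exact hV1 _
  · intro n x
    have := posSemidef_mul_transpose_self (U (e n) x)ᵀ
    rwa [Matrix.transpose_transpose] at this
  · exact fun n x => posSemidef_one_sub_transpose_mul _ (hu3 _ _)
  · intro n
    have h1 : ∀ x, (A (e n) x * (A (e n) x)ᵀ * ((U (e n) x)ᵀ * U (e n) x)).trace
        = (A (e n) x * (A (e n) x)ᵀ).trace := by
      intro x
      rw [trace_mul_projection, trace_mul_transpose_self, Finset.sum_comm (γ := ι)]
      exact Finset.sum_congr rfl fun t _ => hu2 (e n) x t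
    simp only [h1]
    rw [← Matrix.trace_sum, hsumA]
    have h2 := hV2 (e n)
    have h3 := hZ _ (htG (e n).2)
    have h4 : (1 - 2 / 2 ^ m) * d = d - 2 * d / 2 ^ m := by ring
    rw [h4]
    linarith
  · intro n n' hne
    have hnrel : ¬ rel (e n') (e n) := hti _ (e n').2 _ (e n).2 fun h =>
      hne (e.injective (Subtype.ext h)).symm
    have hle := not_lt.mp hnrel
    set ω := (e n : C → ι → Bool) with hω
    set ω' := (e n' : C → ι → Bool) with hω'
    have h1 : ∑ x, (A ω x * (A ω x)ᵀ * ((U ω' x)ᵀ * U ω' x)).trace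
        = ∑ c : C, ∑ l, (∑ i, u ω' c.1 l i * V ω i c) ^ 2 := by
      simp only [trace_mul_projection]
      exact (Fintype.sum_prod_type
        fun c : C => ∑ l, (∑ i, u ω' c.1 l i * V ω i c) ^ 2).symm
    rw [h1]
    have h2 : ∑ c : C, ∑ l, (∑ i, u ω' c.1 l i * V ω i c) ^ 2 ≤
        ∑ c : C, ∑ l, (2 * (∑ i, u ω' c.1 l i * Γ ω i c) ^ 2
          + 2 * (∑ i, u ω' c.1 l i * (V ω - Γ ω) i c) ^ 2) := by
      refine Finset.sum_le_sum fun c _ => Finset.sum_le_sum fun l _ => ?_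
      refine (hsq _ (∑ i, u ω' c.1 l i * Γ ω i c)).trans (le_of_eq ?_)
      rw [← Finset.sum_sub_distrib]
      simp only [Matrix.sub_apply, mul_sub]
    have h3 : ∑ c : C, ∑ l, (∑ i, u ω' c.1 l i * Γ ω i c) ^ 2 ≤ 8 * a := by
      have h4 : ∀ c : C, ∀ l, (∑ i, u ω' c.1 l i * Γ ω i c) ^ 2
          = (∑ i, u ω' c.1 l i * sgn (ω c i)) ^ 2 / D := by
        intro c l
        simp only [Γ, Matrix.of_apply, mul_div_assoc', ← Finset.sum_div, div_pow]
        rw [Real.sq_sqrt hD0.le]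
      simp only [h4, ← Finset.sum_div]
      rw [div_le_iff₀ hD0]
      exact hle
    have h5 : ∑ c : C, ∑ l, (∑ i, u ω' c.1 l i * (V ω - Γ ω) i c) ^ 2 ≤ 2 * d / 2 ^ m := by
      calc _ ≤ ∑ c : C, ∑ i, (V ω - Γ ω) i c ^ 2 :=
            Finset.sum_le_sum fun c _ => hu3 ω' c.1 fun i => (V ω - Γ ω) i c
        _ = ((V ω - Γ ω) * (V ω - Γ ω)ᵀ).trace := by
            rw [trace_mul_transpose_self, Finset.sum_comm]
        _ ≤ _ := (hV3 ω).trans (hZ ω (htG (e n).2))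
    simp only [Finset.sum_add_distrib, ← Finset.mul_sum] at h2
    have h6 : 20 / 2 ^ m * d = 2 * (8 * a) + 2 * (2 * d / 2 ^ m) := by
      rw [hdval]; field_simp; ring
    rw [h6]
    linarith

section PosSemidef

variable {n o : Type*} [Fintype n] [Fintype o]

open scoped MatrixOrder in
theorem PosSemidef.exists_eq_conjTranspose_mul_self {𝕜 : Type*} [RCLike 𝕜] {A : Matrix n n 𝕜}
    (hA : A.PosSemidef) : ∃ B : Matrix n n 𝕜, A = Bᴴ * B := by
  classical
  exact CStarAlgebra.nonneg_iff_eq_star_mul_self.mp hA.nonneg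

theorem PosSemidef.trace_mul_nonneg {A B : Matrix n n ℂ} (hA : A.PosSemidef)
    (hB : B.PosSemidef) : 0 ≤ (A * B).trace := by
  obtain ⟨C, rfl⟩ := PosSemidef.exists_eq_conjTranspose_mul_self hB
  rw [← Matrix.mul_assoc, Matrix.trace_mul_comm, ← Matrix.mul_assoc]
  exact (hA.mul_mul_conjTranspose_same C).trace_nonneg

theorem PosSemidef.map_ofReal {A : Matrix n n ℝ} (hA : A.PosSemidef) :
    (A.map Complex.ofReal).PosSemidef := by
  obtain ⟨B, rfl⟩ := PosSemidef.exists_eq_conjTranspose_mul_self hA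
  have : (Bᴴ * B).map Complex.ofReal
      = (B.map Complex.ofReal)ᴴ * B.map Complex.ofReal := by
    ext i j
    simp [Matrix.mul_apply]
  rw [this]
  exact Matrix.posSemidef_conjTranspose_mul_self _

theorem PosSemidef.blockDiagonal [DecidableEq o] {F : o → Matrix n n ℂ}
    (hF : ∀ x, (F x).PosSemidef) : (Matrix.blockDiagonal F).PosSemidef := by
  refine Matrix.PosSemidef.of_dotProduct_mulVec_nonneg ?_ fun v => ?_
  · rw [Matrix.IsHermitian, Matrix.blockDiagonal_conjTranspose]
    congr 1
    funext x
    exact (hF x).1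
  · have : star v ⬝ᵥ Matrix.blockDiagonal F *ᵥ v
        = ∑ x, star (fun i => v (i, x)) ⬝ᵥ F x *ᵥ (fun i => v (i, x)) := by
      simp only [dotProduct, Matrix.mulVec, Fintype.sum_prod_type, Matrix.blockDiagonal_apply,
        ite_mul, zero_mul, Finset.sum_ite_eq, Finset.mem_univ, if_true, Pi.star_apply]
      exact Finset.sum_comm
    rw [this]
    exact Finset.sum_nonneg fun x _ => (hF x).dotProduct_mulVec_nonneg _

theorem trace_blockDiagonal [DecidableEq o] (F : o → Matrix n n ℂ) :
    (Matrix.blockDiagonal F).trace = ∑ x, (F x).trace := by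
  simp only [Matrix.trace, Fintype.sum_prod_type, Matrix.diag_apply, Matrix.blockDiagonal_apply_eq]
  exact Finset.sum_comm

end PosSemidef

section Channel

variable {a b : Type} [Fintype a] [Fintype b]

/-- The adjoint of a linear map with respect to the trace pairing. -/
noncomputable def traceAdjoint [DecidableEq a] (R : Matrix a a ℂ →ₗ[ℂ] Matrix b b ℂ)
    (D : Matrix b b ℂ) : Matrix a a ℂ :=
  Matrix.of fun i j => (R (Matrix.single j i 1) * D).trace

theorem trace_mul_traceAdjoint [DecidableEq a] (R : Matrix a a ℂ →ₗ[ℂ] Matrix b b ℂ)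
    (D : Matrix b b ℂ) (M : Matrix a a ℂ) :
    (M * traceAdjoint R D).trace = (R M * D).trace := by
  conv_rhs => rw [Matrix.matrix_eq_sum_single M]
  simp only [map_sum, Matrix.sum_mul, Matrix.trace_sum]
  rw [Matrix.trace]
  refine Finset.sum_congr rfl fun i _ => ?_
  rw [Matrix.diag_apply, Matrix.mul_apply]
  refine Finset.sum_congr rfl fun j _ => ?_
  have : Matrix.single i j (M i j) = M i j • Matrix.single i j (1 : ℂ) := by
    rw [Matrix.smul_single, smul_eq_mul, mul_one]
  rw [this, map_smul, Matrix.smul_mul, Matrix.trace_smul, smul_eq_mul]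
  rfl

theorem IsChannel.map_posSemidef {R : Matrix a a ℂ →ₗ[ℂ] Matrix b b ℂ} (hR : IsChannel R)
    {M : Matrix a a ℂ} (hM : M.PosSemidef) : (R M).PosSemidef := by
  have h := hR.completelyPositive Unit (M.submatrix Prod.snd Prod.snd) (hM.submatrix _)
  exact h.submatrix fun x : b => ((), x)

theorem IsChannel.traceAdjoint_posSemidef [DecidableEq a] {R : Matrix a a ℂ →ₗ[ℂ] Matrix b b ℂ}
    (hR : IsChannel R) {D : Matrix b b ℂ} (hD : D.PosSemidef) :
    (traceAdjoint R D).PosSemidef := by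
  have hq : ∀ v : a → ℂ, 0 ≤ star v ⬝ᵥ traceAdjoint R D *ᵥ v := by
    intro v
    have h := PosSemidef.trace_mul_nonneg
      (hR.map_posSemidef (Matrix.posSemidef_vecMulVec_self_star v)) hD
    rw [← trace_mul_traceAdjoint, Matrix.vecMulVec_mul, Matrix.trace_vecMulVec,
      dotProduct_comm, ← Matrix.dotProduct_mulVec] at h
    exact h
  rw [Matrix.posSemidef_iff_dotProduct_mulVec]
  refine ⟨?_, hq⟩
  rw [← Matrix.isSymmetric_toEuclideanLin_iff, LinearMap.isSymmetric_iff_inner_map_self_real]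
  intro v
  have h := hq v.ofLp
  have e : inner ℂ (Matrix.toEuclideanLin (traceAdjoint R D) v) v
      = star (star v.ofLp ⬝ᵥ traceAdjoint R D *ᵥ v.ofLp) := by
    rw [EuclideanSpace.inner_eq_star_dotProduct, dotProduct_comm, Matrix.star_dotProduct]
    rfl
  rw [e, Complex.star_def, Complex.conj_conj]
  exact ((Complex.conj_eq_iff_im.mpr (Complex.le_def.mp h).2.symm)).symm

theorem traceAdjoint_one_sub [DecidableEq a] [DecidableEq b]
    {R : Matrix a a ℂ →ₗ[ℂ] Matrix b b ℂ} (hR : IsChannel R) (D : Matrix b b ℂ) :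
    traceAdjoint R (1 - D) = 1 - traceAdjoint R D := by
  ext i j
  simp only [traceAdjoint, Matrix.of_apply, Matrix.sub_apply, Matrix.mul_sub, Matrix.mul_one,
    Matrix.trace_sub, hR.tracePreserving]
  congr 1
  by_cases h : i = j
  · subst h; simp
  · rw [Matrix.one_apply_ne h, Matrix.trace_single_eq_of_ne _ _ _ (Ne.symm h)]

theorem IsEffect.traceAdjoint [DecidableEq a] [DecidableEq b]
    {R : Matrix a a ℂ →ₗ[ℂ] Matrix b b ℂ} (hR : IsChannel R) {D : Matrix b b ℂ}
    (hD : IsEffect D) : IsEffect (traceAdjoint R D) :=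
  ⟨hR.traceAdjoint_posSemidef hD.nonneg, by
    rw [← traceAdjoint_one_sub hR]
    exact hR.traceAdjoint_posSemidef hD.le_one⟩

theorem isChannel_id : IsChannel (LinearMap.id : Matrix a a ℂ →ₗ[ℂ] Matrix a a ℂ) :=
  ⟨fun _ _ _ hM => hM, fun _ => rfl⟩

/-- The channel that performs the measurement `M` and returns the outcome. -/
noncomputable def measureChannel [DecidableEq b] (M : b → Matrix a a ℂ) :
    Matrix a a ℂ →ₗ[ℂ] Matrix b b ℂ where
  toFun X := Matrix.diagonal fun x => (M x * X).trace
  map_add' X Y := by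
    simp only [Matrix.mul_add, Matrix.trace_add, Matrix.diagonal_add]
  map_smul' c X := by
    ext i j
    by_cases h : i = j
    · subst h; simp
    · simp [h]

theorem isChannel_measureChannel [DecidableEq a] [DecidableEq b] {M : b → Matrix a a ℂ}
    (hM : ∀ x, (M x).PosSemidef) (hsum : ∑ x, M x = 1) : IsChannel (measureChannel M) := by
  refine ⟨fun r _ N hN => ?_, fun X => ?_⟩
  · have hamp : ampl (measureChannel M) N = Matrix.blockDiagonal fun x =>
        Matrix.of fun p q => (M x * Matrix.of fun u v => N (p, u) (q, v)).trace := by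
      ext ⟨p, x⟩ ⟨q, y⟩
      simp only [ampl, measureChannel, Matrix.of_apply, LinearMap.coe_mk, AddHom.coe_mk,
        Matrix.blockDiagonal_apply, Matrix.diagonal_apply]
    rw [hamp]
    refine PosSemidef.blockDiagonal fun x => ?_
    obtain ⟨B, hB⟩ := PosSemidef.exists_eq_conjTranspose_mul_self (hM x)
    have hF : (Matrix.of fun p q => (M x * Matrix.of fun u v => N (p, u) (q, v)).trace)
        = ∑ t, Matrix.of fun p q =>
          ∑ u, ∑ v, B t u * N (p, u) (q, v) * star (B t v) := by
      ext p q
      rw [Matrix.of_apply, hB, Matrix.mul_assoc, Matrix.trace_mul_comm]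
      simp only [Matrix.sum_apply, Matrix.of_apply, Matrix.trace, Matrix.diag_apply,
        Matrix.mul_apply, Matrix.conjTranspose_apply, Finset.sum_mul]
      refine Finset.sum_congr rfl fun t _ => ?_
      exact Finset.sum_comm
    rw [hF]
    refine Matrix.posSemidef_sum _ fun t _ => ?_
    classical
    have := hN.mul_mul_conjTranspose_same
      (Matrix.of fun (p : r) (qu : r × a) => if p = qu.1 then B t qu.2 else 0)
    convert this using 1
    ext p q
    simp only [Matrix.of_apply, Matrix.mul_apply,
      Matrix.conjTranspose_apply, Fintype.sum_prod_type, ite_mul, zero_mul, apply_ite star,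
      star_zero, mul_ite, mul_zero, Finset.sum_mul]
    simp only [← Finset.sum_mul, Finset.sum_ite_irrel, Finset.sum_const_zero,
      Finset.sum_ite_eq, Finset.mem_univ, if_true]
    simp only [Finset.sum_mul]
    exact Finset.sum_comm
  · simp only [measureChannel, LinearMap.coe_mk, AddHom.coe_mk, Matrix.trace_diagonal]
    rw [← Matrix.trace_sum, ← Matrix.sum_mul, hsum, Matrix.one_mul]

theorem assistedState_measureChannel (k Δ : ℕ)
    (M : Fin Δ → Matrix (Qubits k) (Qubits k) ℂ) :
    assistedState k Δ (measureChannel M)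
      = ((2 : ℂ) ^ k)⁻¹ • Matrix.blockDiagonal fun x => (M x)ᵀ := by
  have hc : ∀ i j u v : Qubits k, maxEnt (Qubits k) (i, u) (j, v)
      = if i = u then (if j = v then ((2 : ℂ) ^ k)⁻¹ else 0) else 0 := by
    intro i j u v
    simp only [maxEnt, maxEntVec, Matrix.vecMulVec_apply, Pi.star_apply]
    split_ifs
    · rw [Complex.star_def, Complex.conj_ofReal, ← Complex.ofReal_mul, ← mul_inv,
        Real.mul_self_sqrt (Nat.cast_nonneg _)]
      simp
    · simp
    · simp
    · simp
  ext ⟨i, x⟩ ⟨j, y⟩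
  simp only [assistedState, ampl, measureChannel, Matrix.of_apply, LinearMap.coe_mk,
    AddHom.coe_mk, Matrix.diagonal_apply, Matrix.smul_apply, Matrix.blockDiagonal_apply, hc]
  split_ifs
  · simp [Matrix.trace, Matrix.mul_apply, mul_comm]
  · simp

end Channel

section AssistedCode

/-- An identification code with `N` messages that uses `k` EPR pairs and one transmission of a
`Δ`-dimensional system, with errors `l₁` and `l₂`. -/
def IsAssistedCode (k Δ N : ℕ) (l₁ l₂ : ℝ) : Prop :=
  ∃ (T : Fin N → (Matrix (Qubits k) (Qubits k) ℂ →ₗ[ℂ] Matrix (Fin Δ) (Fin Δ) ℂ))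
    (D : Fin N → Matrix (Qubits k × Fin Δ) (Qubits k × Fin Δ) ℂ),
    (∀ i, IsChannel (T i)) ∧ (∀ i, IsEffect (D i)) ∧
    (∀ i, 1 - l₁ ≤ (assistedState k Δ (T i) * D i).trace.re) ∧
    (∀ i j, i ≠ j → (assistedState k Δ (T i) * D j).trace.re ≤ l₂)

/-- Measurements of the sender, whose outcome she transmits, together with tests conditional on
the outcome, give an identification code. -/
theorem isAssistedCode_of_measurements {k Δ N : ℕ} {l₁ l₂ : ℝ}
    (M P : Fin N → Fin Δ → Matrix (Qubits k) (Qubits k) ℂ)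
    (hM : ∀ n x, (M n x).PosSemidef) (hsum : ∀ n, ∑ x, M n x = 1)
    (hP : ∀ n x, IsEffect (P n x))
    (h₁ : ∀ n, (1 - l₁) * 2 ^ k ≤ ∑ x, (M n x * P n x).trace.re)
    (h₂ : ∀ n n', n ≠ n' → ∑ x, (M n x * P n' x).trace.re ≤ l₂ * 2 ^ k) :
    IsAssistedCode k Δ N l₁ l₂ := by
  have key : ∀ n n', (assistedState k Δ (measureChannel (M n)) *
      Matrix.blockDiagonal fun x => (P n' x)ᵀ).trace.re
        = (∑ x, (M n x * P n' x).trace.re) / 2 ^ k := by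
    intro n n'
    have h : ∀ x, ((M n x)ᵀ * (P n' x)ᵀ).trace = (M n x * P n' x).trace := by
      intro x
      rw [← Matrix.transpose_mul, Matrix.trace_transpose, Matrix.trace_mul_comm]
    rw [assistedState_measureChannel, Matrix.smul_mul, Matrix.trace_smul,
      ← Matrix.blockDiagonal_mul, trace_blockDiagonal]
    simp only [h]
    have hc : ((2 : ℂ) ^ k)⁻¹ = ((((2 : ℝ) ^ k)⁻¹ : ℝ) : ℂ) := by push_cast; rfl
    rw [hc, smul_eq_mul, Complex.re_ofReal_mul, Complex.re_sum]
    ring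
  have h2k : (0 : ℝ) < 2 ^ k := by positivity
  refine ⟨fun n => measureChannel (M n), fun n => Matrix.blockDiagonal fun x => (P n x)ᵀ,
    fun n => isChannel_measureChannel (hM n) (hsum n), fun n => ⟨?_, ?_⟩, fun n => ?_,
    fun n n' hne => ?_⟩
  · exact PosSemidef.blockDiagonal fun x => (hP n x).nonneg.transpose
  · rw [← Matrix.blockDiagonal_one, ← Matrix.blockDiagonal_sub]
    refine PosSemidef.blockDiagonal fun x => ?_
    have := (hP n x).le_one.transpose
    rwa [Matrix.transpose_sub, Matrix.transpose_one] at this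
  · rw [key, le_div_iff₀ h2k]
    exact h₁ n
  · rw [key, div_le_iff₀ h2k]
    exact h₂ n n' hne

theorem isEffect_zero {a : Type} [Fintype a] [DecidableEq a] :
    IsEffect (0 : Matrix a a ℂ) :=
  ⟨Matrix.PosSemidef.zero, by rw [sub_zero]; exact Matrix.PosSemidef.one⟩

theorem isEffect_one {a : Type} [Fintype a] [DecidableEq a] :
    IsEffect (1 : Matrix a a ℂ) :=
  ⟨Matrix.PosSemidef.one, by rw [sub_self]; exact Matrix.PosSemidef.zero⟩

theorem isAssistedCode_two {k Δ : ℕ} (hΔ : 2 ≤ Δ) : IsAssistedCode k Δ 2 0 0 := by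
  let e : Fin 2 → Fin Δ := Fin.castLE hΔ
  have he : Function.Injective e := Fin.castLE_injective hΔ
  refine isAssistedCode_of_measurements (fun n x => if x = e n then 1 else 0)
    (fun n x => if x = e n then 1 else 0) ?_ ?_ ?_ ?_ ?_
  · intro n x
    split_ifs
    · exact Matrix.PosSemidef.one
    · exact Matrix.PosSemidef.zero
  · simp
  · intro n x
    split_ifs
    · exact isEffect_one
    · exact isEffect_zero
  · intro n
    simp [apply_ite Matrix.trace, apply_ite Complex.re, Matrix.trace_one, ← Complex.ofReal_ofNat,
      ← Complex.ofReal_pow]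
  · intro n n' hne
    refine le_of_eq ?_
    rw [zero_mul]
    refine Finset.sum_eq_zero fun x _ => ?_
    by_cases h : x = e n
    · have : x ≠ e n' := fun h' => hne (he (h.symm.trans h'))
      simp [this]
    · simp [h]

theorem trace_map_ofReal_re {a : Type} [Fintype a] (A B : Matrix a a ℝ) :
    (A.map Complex.ofReal * B.map Complex.ofReal).trace.re = (A * B).trace := by
  simp only [Matrix.trace, Matrix.diag_apply, Matrix.mul_apply, Matrix.map_apply,
    Complex.re_sum, ← Complex.ofReal_mul, Complex.ofReal_re]

theorem exists_large_assistedCode {m k Δ : ℕ} (hm : 2 ≤ m) (hmk : m ≤ k) (hΔ : 4 ^ m + 1 ≤ Δ) :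
    ∃ N : ℕ, 2 ^ 2 ^ (2 * k) ≤ N ∧ IsAssistedCode k Δ N (2 / 2 ^ m) (20 / 2 ^ m) := by
  have hcard : Fintype.card (Qubits k) = 2 ^ k := by simp
  have hι : Fintype.card (Qubits k) = 2 ^ m * 2 ^ (k - m) := by
    rw [hcard, ← pow_add, Nat.add_sub_cancel' hmk]
  obtain ⟨N, hN, M, P, hM, hM1, hP, hP1, h₁, h₂⟩ :=
    exists_measurement_code hm (by positivity) hι
  refine ⟨N, ?_, ?_⟩
  · rwa [hcard, ← pow_mul, mul_comm k] at hN
  have hcardR : (Fintype.card (Qubits k) : ℝ) = 2 ^ k := by rw [hcard]; push_cast; rfl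
  rw [hcardR] at h₁ h₂
  have map_one_sub : ∀ A : Matrix (Qubits k) (Qubits k) ℝ,
      (1 - A).map Complex.ofReal = 1 - A.map Complex.ofReal := by
    intro A
    rw [Matrix.map_sub _ Complex.ofReal_sub, Matrix.map_one _ Complex.ofReal_zero
      Complex.ofReal_one]
  let e : Option (Fin (4 ^ m)) → Fin Δ := fun o =>
    Fin.castLE hΔ (o.elim (Fin.last _) Fin.castSucc)
  have he : Function.Injective e := by
    refine (Fin.castLE_injective hΔ).comp fun o o' h => ?_
    rcases o with _ | x <;> rcases o' with _ | y
    · rfl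
    · exact absurd h.symm (Fin.castSucc_lt_last y).ne
    · exact absurd h (Fin.castSucc_lt_last x).ne
    · exact congrArg some (Fin.castSucc_injective _ h)
  let M' : Fin N → Option (Fin (4 ^ m)) → Matrix (Qubits k) (Qubits k) ℂ := fun n o =>
    o.elim ((1 - ∑ x, M n x).map Complex.ofReal) fun x => (M n x).map Complex.ofReal
  let P' : Fin N → Option (Fin (4 ^ m)) → Matrix (Qubits k) (Qubits k) ℂ := fun n o =>
    o.elim 0 fun x => (P n x).map Complex.ofReal
  have ext_of_not : ∀ (F : Option (Fin (4 ^ m)) → Matrix (Qubits k) (Qubits k) ℂ) (y : Fin Δ),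
      y ∉ Set.range e → Function.extend e F 0 y = 0 := fun F y hy =>
    Function.extend_apply' _ _ _ fun ⟨o, ho⟩ => hy ⟨o, ho⟩
  have ext_cases : ∀ (p : Matrix (Qubits k) (Qubits k) ℂ → Prop)
      (F : Option (Fin (4 ^ m)) → Matrix (Qubits k) (Qubits k) ℂ), p 0 → (∀ o, p (F o)) →
      ∀ y, p (Function.extend e F 0 y) := by
    intro p F h0 hF y
    by_cases hy : y ∈ Set.range e
    · obtain ⟨o, rfl⟩ := hy
      rw [he.extend_apply]
      exact hF o
    · rw [ext_of_not F y hy]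
      exact h0
  have tr : ∀ n n', ∑ y, (Function.extend e (M' n) 0 y * Function.extend e (P' n') 0 y).trace.re
      = ∑ x, (M n x * P n' x).trace := by
    intro n n'
    rw [← Fintype.sum_of_injective e he (fun o => (M' n o * P' n' o).trace.re)]
    · rw [Fintype.sum_option]
      simp [M', P', trace_map_ofReal_re]
    · intro y hy
      rw [ext_of_not _ y hy]
      simp
    · intro o
      rw [he.extend_apply, he.extend_apply]
  refine isAssistedCode_of_measurements (fun n => Function.extend e (M' n) 0)
    (fun n => Function.extend e (P' n) 0) ?_ ?_ ?_ ?_ ?_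
  · refine fun n => ext_cases _ _ Matrix.PosSemidef.zero fun o => ?_
    rcases o with _ | x
    · exact PosSemidef.map_ofReal (hM1 n)
    · exact PosSemidef.map_ofReal (hM n x)
  · intro n
    rw [← Fintype.sum_of_injective e he (M' n) _ (ext_of_not _)
      fun o => (he.extend_apply _ _ o).symm, Fintype.sum_option]
    simp only [M', Option.elim, map_one_sub]
    have : (∑ x, M n x).map Complex.ofReal = ∑ x, (M n x).map Complex.ofReal := by
      ext i j
      simp [Matrix.sum_apply]
    rw [this, sub_add_cancel]
  · refine fun n => ext_cases _ _ isEffect_zero fun o => ?_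
    rcases o with _ | x
    · exact isEffect_zero
    · refine ⟨PosSemidef.map_ofReal (hP n x), ?_⟩
      have := PosSemidef.map_ofReal (hP1 n x)
      rwa [map_one_sub] at this
  · intro n
    rw [tr]
    exact h₁ n
  · intro n n' hne
    rw [tr]
    exact h₂ n n' hne

end AssistedCode

theorem le_maxSize_of_supplies {S : System} {n k Δ N : ℕ} {ε l₁ l₂ l₁' l₂' : ℝ}
    (hS : Supplies S n k Δ ε) (hc : IsAssistedCode k Δ N l₁ l₂) (h₁ : l₁ + ε ≤ l₁')
    (h₂ : l₂ + ε ≤ l₂') : (N : ℝ≥0∞) ≤ maxSize S n l₁' l₂' := by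
  obtain ⟨R, hR, hRT⟩ := hS
  obtain ⟨T, D, hT, hD, hf, hs⟩ := hc
  choose σ hσ hσT using fun i => hRT (T i) (hT i)
  refine le_iSup₂_of_le N ⟨σ, fun i => traceAdjoint R (D i), hσ,
    fun i => IsEffect.traceAdjoint hR (hD i), fun i => ?_, fun i j hij => ?_⟩ le_rfl
  · rw [trace_mul_traceAdjoint]
    have := (abs_le.mp (hσT i (D i) (hD i))).1
    linarith [hf i]
  · rw [trace_mul_traceAdjoint]
    have := (abs_le.mp (hσT i (D j) (hD j))).2
    linarith [hs i j hij]

section Log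

theorem log2_mono {x y : ℝ≥0∞} (h : x ≤ y) : log2 x ≤ log2 y := by
  refine EReal.div_le_div_right_of_nonneg ?_ (ENNReal.log_le_log h)
  exact_mod_cast (Real.log_pos one_lt_two).le

theorem loglog_mono {x y : ℝ≥0∞} (h : x ≤ y) : loglog x ≤ loglog y :=
  log2_mono (EReal.toENNReal_le_toENNReal (log2_mono h))

theorem log2_ofReal {x : ℝ} (hx : 0 < x) : log2 (ENNReal.ofReal x) = (Real.logb 2 x : ℝ) := by
  rw [log2, ENNReal.log_ofReal_of_pos hx, ← EReal.coe_div]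
  rfl

theorem loglog_ofReal {x : ℝ} (hx : 1 < x) :
    loglog (ENNReal.ofReal x) = (Real.logb 2 (Real.logb 2 x) : ℝ) := by
  rw [loglog, log2_ofReal (by linarith), EReal.real_coe_toENNReal,
    log2_ofReal (Real.logb_pos one_lt_two hx)]

theorem le_loglog_of_two_pow_two_pow_le {r N : ℕ} {x : ℝ≥0∞} (hN : 2 ^ 2 ^ r ≤ N)
    (hx : (N : ℝ≥0∞) ≤ x) : ((r : ℝ) : EReal) ≤ loglog x := by
  have h1 : (1 : ℝ) < 2 ^ 2 ^ r := one_lt_pow₀ one_lt_two (by positivity)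
  have h2 : loglog (ENNReal.ofReal (2 ^ 2 ^ r)) = ((r : ℝ) : EReal) := by
    rw [loglog_ofReal h1, Real.logb_pow, Real.logb_self_eq_one one_lt_two, mul_one, Nat.cast_pow,
      Nat.cast_ofNat, Real.logb_pow, Real.logb_self_eq_one one_lt_two, mul_one]
  rw [← h2]
  refine loglog_mono (le_trans ?_ hx)
  rw [← ENNReal.ofReal_natCast]
  exact ENNReal.ofReal_le_ofReal (by exact_mod_cast hN)

end Log

/-- The direct part: entanglement at rate `E` and unbounded communication allow identification
at rate `2 E`. -/
theorem two_mul_le_idCapacity {E : ℝ} (hE : 0 ≤ E) {S : System}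
    (hS : SuppliesEntanglementAtRate S E) : ((2 * E : ℝ) : EReal) ≤ idCapacity S := by
  refine le_iInf₂ fun l₁ hl₁ => le_iInf₂ fun l₂ hl₂ => ?_
  set l := min l₁ l₂ with hl
  have hl0 : 0 < l := lt_min hl₁ hl₂
  rcases hE.eq_or_lt with rfl | hE0
  · refine le_liminf_of_le (by isBoundedDefault) ?_
    filter_upwards [hS l hl0 1 one_pos 2] with n hn
    obtain ⟨k, Δ, -, hΔ, hsup⟩ := hn
    have h := le_maxSize_of_supplies hsup (isAssistedCode_two (k := k) hΔ)
      (l₁' := l₁) (l₂' := l₂) (by simp [hl]) (by simp [hl])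
    have h2 := le_loglog_of_two_pow_two_pow_le (r := 0) (by norm_num) h
    rw [mul_zero, EReal.coe_zero]
    refine EReal.div_nonneg ?_ (by exact_mod_cast n.cast_nonneg)
    simpa using h2
  · rw [← EReal.ge_of_forall_gt_iff_ge]
    intro r hr
    have hr' : r < 2 * E := by exact_mod_cast hr
    obtain ⟨m', hm'⟩ := pow_unbounded_of_one_lt (40 / l) (one_lt_two (α := ℝ))
    set m := m' + 2 with hm
    have h20 : 20 / (2 : ℝ) ^ m ≤ l / 2 := by
      have h1 : 40 / l ≤ 2 ^ m := hm'.le.trans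
        (pow_le_pow_right₀ one_le_two (by omega))
      rw [div_le_iff₀ hl0] at h1
      rw [div_le_iff₀ (by positivity)]
      linarith
    have h2 : 2 / (2 : ℝ) ^ m ≤ 20 / 2 ^ m := by gcongr; norm_num
    set δ := min (E / 2) ((2 * E - r) / 2) with hδ
    have hδ0 : 0 < δ := lt_min (by linarith) (by linarith)
    have hbig : ∀ᶠ n : ℕ in atTop, (m : ℝ) / (E / 2) ≤ n :=
      tendsto_natCast_atTop_atTop.eventually_ge_atTop _
    refine le_liminf_of_le (by isBoundedDefault) ?_
    filter_upwards [hS (l / 2) (by positivity) δ hδ0 (4 ^ m + 1), hbig,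
      eventually_gt_atTop 0] with n hn hnm hn0
    obtain ⟨k, Δ, hk, hΔ, hsup⟩ := hn
    have hn0' : (0 : ℝ) < n := by exact_mod_cast hn0
    have hmk : m ≤ k := by
      rw [div_le_iff₀ (by linarith)] at hnm
      have : (E / 2) * n ≤ (E - δ) * n := by
        gcongr
        linarith [min_le_left (E / 2) ((2 * E - r) / 2)]
      have : (m : ℝ) ≤ k := by linarith
      exact_mod_cast this
    obtain ⟨N, hN, hcode⟩ := exists_large_assistedCode (by omega) hmk hΔ
    have h := le_maxSize_of_supplies hsup hcode (l₁' := l₁) (l₂' := l₂)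
      (by linarith [min_le_left l₁ l₂]) (by linarith [min_le_right l₁ l₂])
    have hll := le_loglog_of_two_pow_two_pow_le hN h
    refine le_trans ?_ (EReal.div_le_div_right_of_nonneg (by exact_mod_cast hn0'.le) hll)
    rw [← EReal.coe_div, EReal.coe_le_coe_iff, le_div_iff₀ hn0']
    push_cast
    have : r * n ≤ 2 * (E - δ) * n := by
      gcongr
      linarith [min_le_right (E / 2) ((2 * E - r) / 2)]
    linarith

section Packing

variable {a : Type} [Fintype a]

theorem PosSemidef.norm_apply_le {A : Matrix a a ℂ} (hA : A.PosSemidef) {c : ℝ}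
    (hc : ∀ i, (A i i).re ≤ c) (i j : a) : ‖A i j‖ ≤ c := by
  obtain ⟨B, hB⟩ := PosSemidef.exists_eq_conjTranspose_mul_self hA
  have hd : ∀ i, (A i i).re = ∑ t, ‖B t i‖ ^ 2 := by
    intro i
    rw [hB, Matrix.mul_apply, Complex.re_sum]
    refine Finset.sum_congr rfl fun t _ => ?_
    rw [Matrix.conjTranspose_apply, Complex.star_def, ← Complex.normSq_eq_conj_mul_self,
      Complex.ofReal_re, Complex.normSq_eq_norm_sq]
  have h : ‖A i j‖ ≤ ((A i i).re + (A j j).re) / 2 := by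
    rw [hd, hd, ← Finset.sum_add_distrib, Finset.sum_div, hB, Matrix.mul_apply]
    refine (norm_sum_le _ _).trans (Finset.sum_le_sum fun t _ => ?_)
    rw [Matrix.conjTranspose_apply, norm_mul, norm_star]
    nlinarith [sq_nonneg (‖B t i‖ - ‖B t j‖)]
  linarith [hc i, hc j]

theorem IsState.norm_apply_le {ρ : Matrix a a ℂ} (hρ : IsState ρ) (i j : a) : ‖ρ i j‖ ≤ 1 := by
  refine PosSemidef.norm_apply_le hρ.posSemidef (fun i => ?_) i j
  have h := congrArg Complex.re hρ.trace_eq_one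
  rw [Matrix.trace, Complex.re_sum, Complex.one_re] at h
  rw [← h]
  exact Finset.single_le_sum (f := fun i => (ρ i i).re)
    (fun i _ => (Complex.le_def.mp hρ.posSemidef.diag_nonneg).1) (Finset.mem_univ i)

theorem IsEffect.norm_apply_le [DecidableEq a] {D : Matrix a a ℂ} (hD : IsEffect D) (i j : a) :
    ‖D i j‖ ≤ 1 := by
  refine PosSemidef.norm_apply_le hD.nonneg (fun i => ?_) i j
  have h := (Complex.le_def.mp (hD.le_one.diag_nonneg (i := i))).1
  simpa using h

theorem abs_trace_sub_le [DecidableEq a] {ρ σ D : Matrix a a ℂ} (hD : IsEffect D) {η : ℝ}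
    (h : ∀ i j, ‖ρ i j - σ i j‖ ≤ η) :
    |(ρ * D).trace.re - (σ * D).trace.re| ≤ (Fintype.card a : ℝ) ^ 2 * η := by
  rw [← Complex.sub_re, ← Matrix.trace_sub, ← Matrix.sub_mul]
  refine (Complex.abs_re_le_norm _).trans ?_
  calc ‖((ρ - σ) * D).trace‖ ≤ ∑ i, ∑ j, ‖(ρ - σ) i j * D j i‖ :=
        (norm_sum_le _ _).trans (Finset.sum_le_sum fun i _ => norm_sum_le _ _)
    _ ≤ ∑ _i : a, ∑ _j : a, η * 1 := by
        refine Finset.sum_le_sum fun i _ => Finset.sum_le_sum fun j _ => ?_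
        rw [norm_mul, Matrix.sub_apply]
        exact mul_le_mul (h i j) (hD.norm_apply_le j i) (norm_nonneg _)
          ((norm_nonneg _).trans (h i j))
    _ = _ := by
        simp only [Finset.sum_const, Finset.card_univ, nsmul_eq_mul]
        ring

theorem abs_sub_le_of_floor_eq {s x y : ℝ} (hs : 0 < s) (h : ⌊x * s⌋ = ⌊y * s⌋) :
    |x - y| ≤ 1 / s := by
  have := Int.abs_sub_lt_one_of_floor_eq_floor h
  rw [← sub_mul, abs_mul, abs_of_pos hs] at this
  rw [le_div_iff₀ hs]
  exact this.le

/-- The size of an identification code is bounded in terms of the dimension, by counting the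
cells of a grid. -/
theorem card_le_of_isIDCode {S : System} {n N : ℕ} (hd : 0 < Fintype.card (S.Out n))
    {ρ D : Fin N → Matrix (S.Out n) (S.Out n) ℂ} (h : IsIDCode S n (1 / 4) (1 / 4) ρ D) :
    N ≤ (17 * Fintype.card (S.Out n) ^ 2) ^ (2 * Fintype.card (S.Out n) ^ 2) := by
  set d := Fintype.card (S.Out n) with hd'
  set s : ℤ := 8 * (d : ℤ) ^ 2 with hs
  have hd1 : (1 : ℝ) ≤ d := by exact_mod_cast hd
  have hs0 : (0 : ℝ) < s := by rw [hs]; push_cast; positivity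
  have hfloor : ∀ x : ℝ, |x| ≤ 1 → ⌊x * s⌋ ∈ Finset.Icc (-s) s := by
    intro x hx
    rw [abs_le] at hx
    rw [Finset.mem_Icc]
    constructor
    · rw [Int.le_floor]
      push_cast
      nlinarith
    · have : x * s < s + 1 := by nlinarith
      rw [← Int.lt_add_one_iff, Int.floor_lt]
      exact_mod_cast this
  have hst := fun i => S.isState n (ρ i) (h.state_mem i)
  let f : Fin N → (S.Out n × S.Out n → Finset.Icc (-s) s × Finset.Icc (-s) s) := fun i p =>
    (⟨⌊(ρ i p.1 p.2).re * s⌋, hfloor _ ((Complex.abs_re_le_norm _).trans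
        ((hst i).norm_apply_le _ _))⟩,
      ⟨⌊(ρ i p.1 p.2).im * s⌋, hfloor _ ((Complex.abs_im_le_norm _).trans
        ((hst i).norm_apply_le _ _))⟩)
  have hf : Function.Injective f := by
    intro i j hij
    by_contra hne
    have hclose : ∀ p q, ‖ρ i p q - ρ j p q‖ ≤ 2 / s := by
      intro p q
      have hpq := congrFun hij (p, q)
      simp only [f, Prod.mk.injEq, Subtype.mk.injEq] at hpq
      refine (Complex.norm_le_abs_re_add_abs_im _).trans ?_
      rw [Complex.sub_re, Complex.sub_im]
      have h1 := abs_sub_le_of_floor_eq hs0 hpq.1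
      have h2 := abs_sub_le_of_floor_eq hs0 hpq.2
      have h3 : (2 : ℝ) / s = 1 / s + 1 / s := by ring
      rw [h3]
      exact add_le_add h1 h2
    have h1 := abs_trace_sub_le (h.effect i) hclose
    have h2 : (Fintype.card (S.Out n) : ℝ) ^ 2 * (2 / s) = 1 / 4 := by
      rw [← hd', hs]
      push_cast
      field_simp
      norm_num
    rw [h2] at h1
    have h3 := h.first_kind i
    have h4 := h.second_kind j i (Ne.symm hne)
    have h5 := (abs_le.mp h1).2
    linarith
  have hcard := Fintype.card_le_of_injective f hf
  have hIcc : Fintype.card (Finset.Icc (-s) s) ≤ 17 * d ^ 2 := by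
    rw [Fintype.card_coe, Int.card_Icc]
    have : 1 ≤ (d : ℤ) ^ 2 := by
      have : (1 : ℤ) ≤ d := by exact_mod_cast hd
      nlinarith
    zify
    rw [Int.toNat_of_nonneg (by omega)]
    omega
  rw [Fintype.card_fin, Fintype.card_fun, Fintype.card_prod, Fintype.card_prod, ← hd'] at hcard
  refine hcard.trans ?_
  calc _ ≤ ((17 * d ^ 2) * (17 * d ^ 2)) ^ (d * d) := by gcongr
    _ = _ := by rw [← sq, ← sq, ← pow_mul]

theorem loglog_maxSize_le {S : System} {n : ℕ} (hd : 0 < Fintype.card (S.Out n)) :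
    loglog (maxSize S n (1 / 4) (1 / 4)) ≤
      ((1 + 2 * Real.logb 2 (Fintype.card (S.Out n)) +
        Real.logb 2 (Real.logb 2 17 + 2 * Real.logb 2 (Fintype.card (S.Out n))) : ℝ) : EReal) := by
  set d := Fintype.card (S.Out n) with hd'
  have hd1 : (1 : ℝ) ≤ d := by exact_mod_cast hd
  have hlog17 : 0 < Real.logb 2 17 := Real.logb_pos one_lt_two (by norm_num)
  have hlogd : 0 ≤ Real.logb 2 d := Real.logb_nonneg one_lt_two hd1
  have hx : (1 : ℝ) < (17 * (d : ℝ) ^ 2) ^ (2 * d ^ 2) := by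
    refine one_lt_pow₀ (by nlinarith) (by positivity)
  have hle : maxSize S n (1 / 4) (1 / 4) ≤ ENNReal.ofReal ((17 * (d : ℝ) ^ 2) ^ (2 * d ^ 2)) := by
    refine iSup₂_le fun N hN => ?_
    obtain ⟨ρ, D, hc⟩ := hN
    rw [← ENNReal.ofReal_natCast]
    refine ENNReal.ofReal_le_ofReal ?_
    exact_mod_cast card_le_of_isIDCode hd hc
  have hd0 : (d : ℝ) ^ 2 ≠ 0 := by positivity
  have h17 : Real.logb 2 (17 * (d : ℝ) ^ 2) = Real.logb 2 17 + 2 * Real.logb 2 d := by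
    rw [Real.logb_mul (by norm_num) hd0, Real.logb_pow, Nat.cast_ofNat]
  have h2d : Real.logb 2 ((2 * d ^ 2 : ℕ) : ℝ) = 1 + 2 * Real.logb 2 d := by
    rw [Nat.cast_mul, Nat.cast_pow, Nat.cast_ofNat, Real.logb_mul (by norm_num) hd0,
      Real.logb_pow, Real.logb_self_eq_one one_lt_two, Nat.cast_ofNat]
  have h2d0 : ((2 * d ^ 2 : ℕ) : ℝ) ≠ 0 := by push_cast; positivity
  refine (loglog_mono hle).trans (le_of_eq ?_)
  rw [loglog_ofReal hx, Real.logb_pow, h17, Real.logb_mul h2d0 (by positivity), h2d]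

end Packing

theorem tendsto_logb_natCast_div : Tendsto (fun n : ℕ => Real.logb 2 n / n) atTop (𝓝 0) := by
  have h := (Real.tendsto_pow_log_div_mul_add_atTop 1 0 1 one_ne_zero).comp
    tendsto_natCast_atTop_atTop
  have h2 := h.div_const (Real.log 2)
  rw [zero_div] at h2
  refine h2.congr fun n => ?_
  simp only [Function.comp, pow_one, one_mul, add_zero, Real.logb]
  ring

/-- The converse: the dimension bounds the identification rate. -/
theorem idCapacity_le_of_tendsto_dim {S : System} {E : ℝ}
    (hpos : ∀ n, 0 < Fintype.card (S.Out n))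
    (hdim : Tendsto (fun n : ℕ => Real.logb 2 (Fintype.card (S.Out n)) / n) atTop (𝓝 E)) :
    idCapacity S ≤ ((2 * E : ℝ) : EReal) := by
  set x : ℕ → ℝ := fun n => Real.logb 2 (Fintype.card (S.Out n)) with hx
  have hx0 : ∀ n, 0 ≤ x n := fun n =>
    Real.logb_nonneg one_lt_two (by exact_mod_cast hpos n)
  have hlog17 : 0 < Real.logb 2 17 := Real.logb_pos one_lt_two (by norm_num)
  set c : ℝ := Real.logb 2 17 + 2 * (|E| + 1) with hc
  have hc0 : 0 < c := by positivity
  have hlim : Tendsto (fun n : ℕ => 1 / (n : ℝ) + 2 * (x n / n) +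
      (Real.logb 2 c / n + Real.logb 2 n / n)) atTop (𝓝 (2 * E)) := by
    have h := (tendsto_one_div_atTop_nhds_zero_nat (𝕜 := ℝ)).add (hdim.const_mul 2) |>.add
      ((tendsto_const_div_atTop_nhds_zero_nat (Real.logb 2 c)).add tendsto_logb_natCast_div)
    simpa using h
  have hlim' := (continuous_coe_real_ereal.tendsto (2 * E)).comp hlim
  calc idCapacity S ≤ liminf (fun n : ℕ =>
        loglog (maxSize S n (1 / 4) (1 / 4)) / ((n : ℝ) : EReal)) atTop :=
        (iInf₂_le (1 / 4 : ℝ) (by norm_num)).trans (iInf₂_le (1 / 4 : ℝ) (by norm_num))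
    _ ≤ liminf (fun n : ℕ => ((1 / (n : ℝ) + 2 * (x n / n) +
          (Real.logb 2 c / n + Real.logb 2 n / n) : ℝ) : EReal)) atTop := by
        refine liminf_le_liminf ?_
        have hev : ∀ᶠ n in atTop, x n / n < |E| + 1 :=
          hdim.eventually_lt_const (by linarith [le_abs_self E])
        filter_upwards [hev, eventually_gt_atTop 0] with n hn hn0
        have hn0' : (0 : ℝ) < n := by exact_mod_cast hn0
        have hn1 : (1 : ℝ) ≤ n := by exact_mod_cast hn0
        refine (EReal.div_le_div_right_of_nonneg (by exact_mod_cast hn0'.le)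
          (loglog_maxSize_le (hpos n))).trans ?_
        rw [← EReal.coe_div, EReal.coe_le_coe_iff]
        have hy : Real.logb 2 (Real.logb 2 17 + 2 * x n) ≤ Real.logb 2 c + Real.logb 2 n := by
          rw [← Real.logb_mul hc0.ne' hn0'.ne']
          refine Real.logb_le_logb_of_le one_lt_two (by linarith [hx0 n]) ?_
          rw [div_lt_iff₀ hn0'] at hn
          rw [hc, add_mul]
          nlinarith
        have e : 1 / (n : ℝ) + 2 * (x n / n) + (Real.logb 2 c / n + Real.logb 2 n / n)
            = (1 + 2 * x n + (Real.logb 2 c + Real.logb 2 n)) / n := by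
          field_simp
        rw [e]
        gcongr
    _ = _ := hlim'.liminf_eq

theorem supplies_entanglementOnly (k Δ : ℕ → ℕ) (n : ℕ) {ε : ℝ} (hε : 0 ≤ ε) :
    Supplies (entanglementOnly k Δ) n (k n) (Δ n) ε :=
  ⟨(LinearMap.id : Matrix (Qubits (k n) × Fin (Δ n)) (Qubits (k n) × Fin (Δ n)) ℂ →ₗ[ℂ] _),
    isChannel_id, fun T hT => ⟨_, ⟨T, hT, rfl⟩, fun D _ =>
      (abs_eq_zero.mpr (sub_self (assistedState (k n) (Δ n) T * D).trace.re)).trans_le hε⟩⟩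

theorem suppliesEntanglementAtRate_entanglementOnly {k Δ : ℕ → ℕ} {E : ℝ}
    (hk : Tendsto (fun n : ℕ => (k n : ℝ) / n) atTop (𝓝 E)) (hΔ : Tendsto Δ atTop atTop) :
    SuppliesEntanglementAtRate (entanglementOnly k Δ) E := by
  intro ε hε δ hδ M
  filter_upwards [hk.eventually_const_lt (sub_lt_self E hδ), hΔ.eventually_ge_atTop M,
    eventually_gt_atTop 0] with n hn hM hn0
  have hn0' : (0 : ℝ) < n := by exact_mod_cast hn0
  exact ⟨k n, Δ n, ((lt_div_iff₀ hn0').mp hn).le, hM, supplies_entanglementOnly k Δ n hε.le⟩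

theorem idCapacity_entanglementOnly_le {k Δ : ℕ → ℕ} {E : ℝ}
    (hk : Tendsto (fun n : ℕ => (k n : ℝ) / n) atTop (𝓝 E)) (hΔ0 : ∀ n, 0 < Δ n)
    (hΔ : Tendsto (fun n : ℕ => Real.logb 2 (Δ n) / n) atTop (𝓝 0)) :
    idCapacity (entanglementOnly k Δ) ≤ ((2 * E : ℝ) : EReal) := by
  have hcard : ∀ n, Fintype.card ((entanglementOnly k Δ).Out n) = 2 ^ k n * Δ n := by
    intro n
    change Fintype.card (Qubits (k n) × Fin (Δ n)) = _
    simp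
  refine idCapacity_le_of_tendsto_dim (fun n => ?_) ?_
  · rw [hcard]
    exact Nat.mul_pos (by positivity) (hΔ0 n)
  · have h := hk.add hΔ
    rw [add_zero] at h
    refine h.congr fun n => ?_
    have hΔn : (Δ n : ℝ) ≠ 0 := by exact_mod_cast (hΔ0 n).ne'
    rw [hcard, Nat.cast_mul, Nat.cast_pow, Nat.cast_ofNat, Real.logb_mul (by positivity) hΔn,
      Real.logb_pow, Real.logb_self_eq_one one_lt_two, mul_one, add_div]

end QuantumID

theorem mainTheorem3 (E : ℝ) (hE : 0 ≤ E) :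
    (∀ S : QuantumID.System, QuantumID.SuppliesEntanglementAtRate S E →
      ((2 * E : ℝ) : EReal) ≤ QuantumID.idCapacity S) ∧
    (∀ k Δ : ℕ → ℕ,
      Tendsto (fun n : ℕ => (k n : ℝ) / n) atTop (𝓝 E) →
      (∀ n, 0 < Δ n) →
      Tendsto (fun n : ℕ => Real.logb 2 (Δ n) / n) atTop (𝓝 0) →
      QuantumID.idCapacity (QuantumID.entanglementOnly k Δ) ≤ ((2 * E : ℝ) : EReal) ∧
      (Tendsto Δ atTop atTop →
        QuantumID.idCapacity (QuantumID.entanglementOnly k Δ) = ((2 * E : ℝ) : EReal))) := by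
  refine ⟨fun S hS => QuantumID.two_mul_le_idCapacity hE hS, fun k Δ hk hΔ0 hΔ => ?_⟩
  have hle := QuantumID.idCapacity_entanglementOnly_le hk hΔ0 hΔ
  exact ⟨hle, fun hΔ' => le_antisymm hle (QuantumID.two_mul_le_idCapacity hE
    (QuantumID.suppliesEntanglementAtRate_entanglementOnly hk hΔ'))⟩
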